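/- **Setting.** There are $K\ge1$ rates $0<r_1<\dots<r_K$. In each slot $t=1,2,\dots$ one rate $k(t)$ is selected, and reward $r_{k(t)}X_{k(t)}(t)$ is received, where $X_k(t)$ is Bernoulli with mean $\theta_k(t)$ and the vectors $(X_k(t))_{k}$ are independent over $t$ (arbitrarily correlated over $k$). The function $\theta$ is deterministic, and $k(t)$ may depend only on the past (and on independent randomization, to break ties). The regret is $$R(T)=\sum_{t=1}^T\mathbb E\Big[\max_k r_k\theta_k(t)-r_{k(t)}\theta_{k(t)}(t)\Big].$$ **Assumptions.** Let $\sigma>0$, let $\Phi$ be a function of the number of rates with $0<\Phi(K)\le K$, and let $\Delta_0>0$. 1. (Lipschitz drift) $|\theta_k(t')-\theta_k(t)|\le\sigma|t'-t|$ for all $k,t,t'$. 2. (Unimodality is preserved) For every $t$, $\theta(t)\in[0,1]^K$ and there is $k^\star$ such that $k\mapsto r_k\theta_k(t)$ is nondecreasing on $\{1,\dots,k^\star\}$ and nonincreasing on $\{k^\star,\dots,K\}$. 3. (Separation) With $N_n(k)=\{l\in\{k-1,k+1\}\cap\{1,\dots,K\}:r_k\theta_k(n)\le r_l\}$ and $$H(\Delta,T)=\sum_{n=1}^T\sum_{k=1}^K\sum_{l\in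 N_n(k)}\mathbf 1\{|r_k\theta_k(n)-r_l\theta_l(n)|\le\Delta\},$$ one has $\limsup_{T\to\infty}H(\Delta,T)/T\le\Phi(K)\Delta/r_1$ for all $0<\Delta\le\Delta_0$. **Algorithm (SW-KL-R-UCB with window size $\tau$ and parameter $c>0$).** Let $t_k^\tau(n)$ be the number of slots $t\ge1$ with $n-\tau\le t\le n-1$ and $k(t)=k$, and let $\hat\mu_k^\tau(n)$ be the average of the rewards $r_kX_k(t)$ over these slots ($0$ if there are none). Let $I(p,q)$ be the Kullback–Leibler divergence between Bernoulli laws of means $p$ and $q$, and $$q_k^\tau(n)=\max\Big\{q\in[0,r_k]:\ t_k^\tau(n)\,I\big(\hat\mu_k^\tau(n)/r_k,\,q/r_k\big)\le\log\tau+c\log\log\tau\Big\}.$$ Select $k(n)=n$ for $n=1,\dots,K$, and $k(n)\in\arg\max_kq_k^\tau(n)$ for $n>K$, ties being broken arbitrarily. **Claim.** There is a constant $C>0$ such that, for all $K$, $(r_k)$, $c$, $\Phi$ and $\Delta_0$ as above, there is $\sigma_0>0$ (depending on these data but not on $\theta$) such that for all $0<\sigma<\sigma_0$ and all $\theta$ satisfying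 assumptions 1–3, SW-KL-R-UCB with $\tau=(K\sigma/\Phi(K))^{-4/5}/4$ satisfies $$\limsup_{T\to\infty}\frac{R(T)}{T}\le C\,\Phi(K)\Big(\frac{K\sigma}{\Phi(K)}\Big)^{2/5}\log(1/\sigma).$$ -/

import Mathlib

open MeasureTheory ProbabilityTheory Filter
open scoped Topology

noncomputable section

namespace RateBandit

/-! ### Rates, drift, unimodality and separation

There are `K` rates `r : Fin K → ℝ` (indexed from `0`), and `θ t k` is the success probability
of rate `k` in slot `t`; slots are `t = 1, 2, …`, so the value at `t = 0` is never used. -/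

/-- `σ`-Lipschitz drift of every success probability over the slots `t = 1, 2, …`. -/
def LipschitzDrift {K : ℕ} (σ : ℝ) (θ : ℕ → Fin K → ℝ) : Prop :=
  ∀ k : Fin K, ∀ t t' : ℕ, 1 ≤ t → 1 ≤ t' →
    |θ t' k - θ t k| ≤ σ * |(t' : ℝ) - (t : ℝ)|

/-- The closed unimodality class: `η ∈ [0,1]^K`, and the throughputs `r_k η_k` are nondecreasing
up to some index and nonincreasing from that index on. -/
def WeaklyUnimodal {K : ℕ} (r : Fin K → ℝ) (η : Fin K → ℝ) : Prop :=
  (∀ k, 0 ≤ η k ∧ η k ≤ 1) ∧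
    ∃ kstar : Fin K,
      MonotoneOn (fun k => r k * η k) (Set.Iic kstar) ∧
        AntitoneOn (fun k => r k * η k) (Set.Ici kstar)

/-- The neighbourhood `N(k) = {l ∈ {k - 1, k + 1} : r_k η_k ≤ r_l}`. -/
def neighbors {K : ℕ} (r : Fin K → ℝ) (η : Fin K → ℝ) (k : Fin K) : Finset (Fin K) :=
  Finset.univ.filter fun l =>
    ((l : ℕ) + 1 = (k : ℕ) ∨ (l : ℕ) = (k : ℕ) + 1) ∧ r k * η k ≤ r l

/-- `H(Δ, T)`: the number of triples (slot `n ≤ T`, rate `k`, neighbour of `k`) for which the two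
throughputs are not separated by more than `Δ`. -/
def closeCount {K : ℕ} (r : Fin K → ℝ) (θ : ℕ → Fin K → ℝ) (Δ : ℝ) (T : ℕ) : ℝ :=
  ∑ n ∈ Finset.Icc 1 T, ∑ k : Fin K, ∑ l ∈ neighbors r (θ n) k,
    if |r k * θ n k - r l * θ n l| ≤ Δ then (1 : ℝ) else 0

/-- Separation at the scales `Δ ∈ (0, Δ₀]`: `limsup_T H(Δ, T) / T ≤ φ Δ / r_1`. -/
def Separated {K : ℕ} [NeZero K] (r : Fin K → ℝ) (θ : ℕ → Fin K → ℝ) (φ Δ₀ : ℝ) : Prop :=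
  ∀ Δ : ℝ, 0 < Δ → Δ ≤ Δ₀ →
    limsup (fun T : ℕ => closeCount r θ Δ T / (T : ℝ)) atTop ≤ φ * Δ / r 0

/-! ### The Bernoulli Kullback-Leibler divergence -/

/-- `a log (a / b)`, with `0 log (0 / b) = 0` and `a log (a / 0) = +∞` for `a ≠ 0`. -/
def klTerm (a b : ℝ) : EReal :=
  if a = 0 then 0 else if b = 0 then ⊤ else ((a * Real.log (a / b) : ℝ) : EReal)

/-- `I(p, q)` for `p, q ∈ [0,1]`. -/
def bernoulliKL (p q : ℝ) : EReal :=
  klTerm p q + klTerm (1 - p) (1 - q)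

/-! ### The sliding-window statistics and indices

These are functions of a sample path: `κ t` is the rate selected in slot `t`, and `x t k` tells
whether a transmission at rate `k` in slot `t` is successful. Only `x t (κ t)` is ever used. -/

/-- The slots `t ≥ 1` with `n - τ ≤ t ≤ n - 1` (the window size `τ` may be any real). -/
def window (τ : ℝ) (n : ℕ) : Finset ℕ :=
  (Finset.Ico 1 n).filter fun t => (n : ℝ) - τ ≤ (t : ℝ)

/-- `t_k^τ(n)`: how often rate `k` was selected in the window preceding slot `n`. -/
def pulls {K : ℕ} (τ : ℝ) (κ : ℕ → Fin K) (n : ℕ) (k : Fin K) : ℕ :=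
  ((window τ n).filter fun t => κ t = k).card

/-- The empirical average reward of rate `k` over the window; it is `0` if `k` was not selected. -/
def empiricalReward {K : ℕ} (r : Fin K → ℝ) (τ : ℝ) (κ : ℕ → Fin K) (x : ℕ → Fin K → Bool)
    (n : ℕ) (k : Fin K) : ℝ :=
  (∑ t ∈ (window τ n).filter (fun t => κ t = k), r k * (if x t k = true then (1 : ℝ) else 0)) /
    (pulls τ κ n k : ℝ)

/-- The index `q_k^τ(n)`. -/
def klIndex {K : ℕ} (r : Fin K → ℝ) (c τ : ℝ) (κ : ℕ → Fin K) (x : ℕ → Fin K → Bool)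
    (n : ℕ) (k : Fin K) : ℝ :=
  sSup {q : ℝ | 0 ≤ q ∧ q ≤ r k ∧
    (((pulls τ κ n k : ℕ) : ℝ) : EReal) *
        bernoulliKL (empiricalReward r τ κ x n k / r k) (q / r k) ≤
      ((Real.log τ + c * Real.log (Real.log τ) : ℝ) : EReal)}

/-- A sample path follows SW-KL-R-UCB with window size `τ`: each rate is selected once in the
slots `1, …, K`, in order, and afterwards a rate with the largest index is selected. -/
def FollowsSWKLRUCB {K : ℕ} (r : Fin K → ℝ) (c τ : ℝ) (κ : ℕ → Fin K)
    (x : ℕ → Fin K → Bool) : Prop :=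
  (∀ n : ℕ, 1 ≤ n → n ≤ K → (κ n : ℕ) + 1 = n) ∧
    ∀ n : ℕ, K < n → ∀ j : Fin K, klIndex r c τ κ x n j ≤ klIndex r c τ κ x n (κ n)

/-! ### The random environment, the algorithm and its regret -/

/-- `X t k` is the success or failure of rate `k` in slot `t`: a Bernoulli variable of mean
`θ t k`, observable at the end of slot `t`. The vectors `X t` are independent over time (each one
is independent of the past `ℱ (t - 1)`); within a slot the rates may be correlated. -/
structure IsEnvironment {K : ℕ} {Ω : Type*} [MeasurableSpace Ω] (P : Measure Ω)
    (θ : ℕ → Fin K → ℝ) (ℱ : Filtration ℕ ‹MeasurableSpace Ω›)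
    (X : ℕ → Ω → Fin K → Bool) : Prop where
  adapted : ∀ t : ℕ, 1 ≤ t → Measurable[ℱ t] (X t)
  indep : ∀ t : ℕ, Indep (MeasurableSpace.comap (X (t + 1)) inferInstance) (ℱ t) P
  mean : ∀ t : ℕ, 1 ≤ t → ∀ k : Fin K, P.real {ω | X t ω k = true} = θ t k

/-- `κ` is the (random) sequence of selections of SW-KL-R-UCB with window size `τ`. Ties are broken
arbitrarily, possibly at random, but without knowledge of the current and future outcomes. -/
structure IsSWKLRUCB {K : ℕ} {Ω : Type*} [MeasurableSpace Ω] (P : Measure Ω)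
    (r : Fin K → ℝ) (c τ : ℝ) (ℱ : Filtration ℕ ‹MeasurableSpace Ω›)
    (X : ℕ → Ω → Fin K → Bool) (κ : ℕ → Ω → Fin K) : Prop where
  predictable : ∀ t : ℕ, Measurable[ℱ t] (κ (t + 1))
  follows : ∀ᵐ ω ∂P, FollowsSWKLRUCB r c τ (fun t => κ t ω) (fun t => X t ω)

/-- The expected regret `R(T)` against the best rate in every slot. -/
def regret {K : ℕ} {Ω : Type*} [MeasurableSpace Ω] (P : Measure Ω)
    (r : Fin K → ℝ) (θ : ℕ → Fin K → ℝ) (κ : ℕ → Ω → Fin K) (T : ℕ) : ℝ :=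
  ∑ t ∈ Finset.Icc 1 T, ∫ ω, ((⨆ k : Fin K, r k * θ t k) - r (κ t ω) * θ t (κ t ω)) ∂P

end RateBandit

end

open MeasureTheory ProbabilityTheory Filter
open scoped Topology

noncomputable section

namespace RateBandit

/-! ### The Bernoulli divergence -/

/-! Put f = log τ + c log log τ and η = (log τ / τ)^(1/4). The window size is tuned so that the
drift στ over a window is at most η. After the K initial slots, a slot can cost regret for four
reasons. (a) The index of the best rate falls below its throughput by more than the drift allows. By
`exists_dominating_of_klIndex_lt` this has probability of order log τ · exp(-f/2); peeling over the
random number of pulls costs the logarithm and half of the exponent. (b) The selected rate has at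
least 4f/η² pulls in the window but too large an empirical mean. By
`exists_dominating_of_le_outcomeCount` this has probability at most K exp(-f). (c) The selected rate
has fewer pulls. By `card_underexplored_le` this concerns a fraction of slots of order K f/(η²τ).
(d) None of these. Then the gap is O(η) by `gap_le_of_follows`, and unimodality produces two
neighbouring rates equally close (`one_le_sum_close`). Separation bounds the frequency of such slots
by O(η), so they cost O(η²) on average. Both probabilities come from products of factors of
conditional mean at most one (`integral_pathWeight_le_one`), which tolerate adaptive sampling and
drift. Terms (c) and (d) are of order √(log τ / τ), (a) is of order (log τ)^(1-c/2)/√τ, and (b) is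
at most K/√τ. All are o(log τ / √τ), so for small σ every constant depending on the data is absorbed
and C = 1 suffices. -/

/-- This is log u ≤ u - 1 at u = √(b / a). Added over successes and failures, the left sides give
the squared Hellinger distance. -/
theorem hellinger_le_klTerm {a b : ℝ} (ha : 0 ≤ a) (hb : 0 ≤ b) :
    ((2 * (a - √(a * b)) : ℝ) : EReal) ≤ klTerm a b := by
  unfold klTerm
  split_ifs with h0 h1
  · simp [h0]
  · exact le_top
  · rw [EReal.coe_le_coe_iff]
    have ha' : 0 < a := lt_of_le_of_ne ha (Ne.symm h0)
    have hb' : 0 < b := lt_of_le_of_ne hb (Ne.symm h1)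
    have h2 : Real.log (a / b) = -2 * Real.log √(b / a) := by
      rw [Real.log_sqrt (by positivity), ← inv_div b a, Real.log_inv]; ring
    have h3 : Real.log √(b / a) ≤ √(b / a) - 1 := Real.log_le_sub_one_of_pos (by positivity)
    have h4 : a * √(b / a) = √(a * b) := by
      rw [← Real.sqrt_sq ha, ← Real.sqrt_mul (by positivity), Real.sqrt_sq ha]
      congr 1; field_simp
    rw [h2, ← h4]
    nlinarith [mul_le_mul_of_nonneg_left h3 ha]

theorem sq_sub_le_four_mul_sq_sqrt_sub {a b : ℝ} (ha : 0 ≤ a) (ha1 : a ≤ 1) (hb : 0 ≤ b)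
    (hb1 : b ≤ 1) : (a - b) ^ 2 ≤ 4 * (√a - √b) ^ 2 := by
  have h : (a - b) ^ 2 = (√a - √b) ^ 2 * (√a + √b) ^ 2 := by
    rw [← mul_pow]
    congr 1
    nlinarith [Real.mul_self_sqrt ha, Real.mul_self_sqrt hb]
  have h1 : √a ≤ 1 := Real.sqrt_le_one.mpr ha1
  have h2 : √b ≤ 1 := Real.sqrt_le_one.mpr hb1
  have h3 : (√a + √b) ^ 2 ≤ 2 ^ 2 :=
    pow_le_pow_left₀ (by positivity) (by linarith) 2
  rw [h]
  nlinarith [mul_le_mul_of_nonneg_left h3 (sq_nonneg (√a - √b))]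

/-- A Pinsker-type inequality. -/
theorem half_sq_sub_le_bernoulliKL {p q : ℝ} (hp : 0 ≤ p) (hp1 : p ≤ 1) (hq : 0 ≤ q)
    (hq1 : q ≤ 1) : (((p - q) ^ 2 / 2 : ℝ) : EReal) ≤ bernoulliKL p q := by
  have hp' : 0 ≤ 1 - p := by linarith
  have hq' : 0 ≤ 1 - q := by linarith
  refine le_trans ?_ (add_le_add (hellinger_le_klTerm hp hq) (hellinger_le_klTerm hp' hq'))
  rw [← EReal.coe_add, EReal.coe_le_coe_iff, Real.sqrt_mul hp, Real.sqrt_mul hp']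
  have h1 := sq_sub_le_four_mul_sq_sqrt_sub hp hp1 hq hq1
  have h2 := sq_sub_le_four_mul_sq_sqrt_sub hp' (by linarith) hq' (by linarith)
  -- The left side is (√p - √q)² + (√(1-p) - √(1-q))², and each square is at least (p - q)² / 4.
  nlinarith [Real.mul_self_sqrt hp, Real.mul_self_sqrt hq, Real.mul_self_sqrt hp',
    Real.mul_self_sqrt hq']

theorem bernoulliKL_self (p : ℝ) : bernoulliKL p p = 0 := by
  have h (a : ℝ) : klTerm a a = 0 := by
    unfold klTerm
    split_ifs with h0
    · rfl
    · simp [div_self h0]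
  simp [bernoulliKL, h]

theorem bernoulliKL_eq_coe {p q : ℝ} (hq : 0 < q) (hq1 : q < 1) :
    bernoulliKL p q =
      ((p * Real.log (p / q) + (1 - p) * Real.log ((1 - p) / (1 - q)) : ℝ) : EReal) := by
  have h {a b : ℝ} (hb : b ≠ 0) : klTerm a b = ((a * Real.log (a / b) : ℝ) : EReal) := by
    unfold klTerm
    split_ifs with h0
    · simp [h0]
    · rfl
  rw [bernoulliKL, h hq.ne', h (by linarith), ← EReal.coe_add]

theorem half_sq_sub_le_of_mul_bernoulliKL_le {p q f : ℝ} {t : ℕ} (hp : 0 ≤ p)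
    (hp1 : p ≤ 1) (hq : 0 ≤ q) (hq1 : q ≤ 1)
    (h : (((t : ℕ) : ℝ) : EReal) * bernoulliKL p q ≤ (f : EReal)) :
    (t : ℝ) * ((p - q) ^ 2 / 2) ≤ f := by
  rw [← EReal.coe_le_coe_iff, EReal.coe_mul]
  refine le_trans (mul_le_mul_of_nonneg_left (half_sq_sub_le_bernoulliKL hp hp1 hq hq1) ?_) h
  exact_mod_cast Nat.cast_nonneg t

/-! ### Likelihood ratios of Bernoulli samples -/

/-- If a sample of size `t ∈ [u, 2 u]` with `S` successes has mean `x = S / t ≤ z < p`, then the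
likelihood ratio of `z` against `p` is at least `exp (u I(z, p))`. -/
theorem exp_le_likelihoodRatio {z p : ℝ} (hz : 0 ≤ z) (hzp : z < p) (hp1 : p < 1) {S F : ℕ}
    {g : ℝ} (hS : (S : ℝ) ≤ (S + F) * z)
    (hg : g ≤ (S + F) * (z * Real.log (z / p) + (1 - z) * Real.log ((1 - z) / (1 - p)))) :
    Real.exp g ≤ (z / p) ^ S * ((1 - z) / (1 - p)) ^ F := by
  have hp : 0 < p := by linarith
  have hb : 0 < (1 - z) / (1 - p) := div_pos (by linarith) (by linarith)
  have hlb : 0 ≤ Real.log ((1 - z) / (1 - p)) := by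
    apply Real.log_nonneg
    rw [le_div_iff₀ (by linarith)]; linarith
  -- At `z = 0` the success factor has no logarithm, but then `S = 0` and it is raised to the power
  -- 0.
  rcases hz.eq_or_lt with rfl | hz
  · have : S = 0 := by
      have : (S : ℝ) ≤ 0 := by simpa using hS
      exact_mod_cast le_antisymm this (Nat.cast_nonneg S)
    subst this
    simp only [pow_zero, one_mul]
    rw [← Real.exp_log hb, ← Real.exp_nat_mul, Real.exp_le_exp]
    simpa using hg
  · have ha : 0 < z / p := by positivity
    have hla : Real.log (z / p) ≤ 0 := by
      apply Real.log_nonpos ha.le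
      rw [div_le_one hp]; exact hzp.le
    rw [← Real.exp_log ha, ← Real.exp_log hb, ← Real.exp_nat_mul, ← Real.exp_nat_mul,
      ← Real.exp_add, Real.exp_le_exp]
    -- For fixed sample size the log-likelihood ratio is affine in `S` with nonpositive slope, so
    -- replacing `S` by (S + F) z only lowers it.
    nlinarith [mul_nonneg (sub_nonneg.mpr hS) (sub_nonneg.mpr (hla.trans hlb))]

/-- One alternative `z` serves all samples whose size lies in `[u, 2 u]`. -/
theorem exists_likelihoodRatio_bound {p f : ℝ} (hp : 0 < p) (hp1 : p < 1) (hf : 0 ≤ f) (u : ℕ) :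
    ∃ z : ℝ, 0 ≤ z ∧ z ≤ p ∧ ∀ S F : ℕ, u ≤ S + F → S + F ≤ 2 * u →
      (S : ℝ) < (S + F) * p →
      f < (S + F) * ((S : ℝ) / (S + F) * Real.log ((S : ℝ) / (S + F) / p) +
        (1 - (S : ℝ) / (S + F)) * Real.log ((1 - (S : ℝ) / (S + F)) / (1 - p))) →
      Real.exp (f / 2) ≤ (z / p) ^ S * ((1 - z) / (1 - p)) ^ F := by
  classical
  set kl : ℝ → ℝ := fun x => x * Real.log (x / p) + (1 - x) * Real.log ((1 - x) / (1 - p)) with hkl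
  set mean : ℕ × ℕ → ℝ := fun a => (a.1 : ℝ) / (a.1 + a.2) with hmean
  set A : Finset (ℕ × ℕ) := (Finset.range (2 * u + 1) ×ˢ Finset.range (2 * u + 1)).filter
    fun a => mean a < p ∧ f < 2 * u * kl (mean a) with hA
  have hmem (S F : ℕ) (h2 : S + F ≤ 2 * u) (h3 : (S : ℝ) < (S + F) * p)
      (h4 : f < (S + F) * kl ((S : ℝ) / (S + F))) : (S, F) ∈ A := by
    have h0 : (0 : ℝ) < S + F := by
      rcases (by positivity : (0 : ℝ) ≤ (S : ℝ) + F).eq_or_lt with h | h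
      · rw [← h] at h3
        have : (0 : ℝ) ≤ S := by positivity
        linarith
      · exact h
    have hpos : 0 < kl ((S : ℝ) / (S + F)) := by
      by_contra hneg
      push Not at hneg
      nlinarith
    have h2' : (S : ℝ) + F ≤ 2 * u := by exact_mod_cast h2
    simp only [hA, Finset.mem_filter, Finset.mem_product, Finset.mem_range, hmean]
    refine ⟨⟨by omega, by omega⟩, by rw [div_lt_iff₀ h0]; linarith, ?_⟩
    exact h4.trans_le (mul_le_mul_of_nonneg_right h2' hpos.le)
  rcases A.eq_empty_or_nonempty with hE | hne
  · refine ⟨p, hp.le, le_rfl, fun S F _ h2 h3 h4 => ?_⟩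
    have := hmem S F h2 h3 h4
    simp [hE] at this
  · obtain ⟨a, ha, hmax⟩ := A.exists_max_image mean hne
    have ha' := ha
    simp only [hA, Finset.mem_filter] at ha'
    obtain ⟨-, hzp, hzf⟩ := ha'
    refine ⟨mean a, by simp only [hmean]; positivity, hzp.le, fun S F h1 h2 h3 h4 => ?_⟩
    have hle := hmax _ (hmem S F h2 h3 h4)
    have h0 : (0 : ℝ) ≤ (S : ℝ) + F := by positivity
    refine exp_le_likelihoodRatio (by simp only [hmean]; positivity) hzp hp1 ?_ ?_
    · rcases h0.eq_or_lt with h | h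
      · have : (0 : ℝ) ≤ S := by positivity
        rw [← h] at h3; linarith
      · simp only [hmean] at hle
        rw [div_le_iff₀ h] at hle
        linarith
    · have h1' : (u : ℝ) ≤ S + F := by exact_mod_cast h1
      have hpos : 0 < kl (mean a) := by
        by_contra hneg
        push Not at hneg
        have : (0 : ℝ) ≤ u := by positivity
        nlinarith
      have := mul_le_mul_of_nonneg_right h1' hpos.le
      change f / 2 ≤ (S + F) * kl (mean a)
      linarith

/-! ### Exponential weights of a sample path -/

/-- The product, over the slots of `W` in which rate `k` is selected, of `a` for a success and `b`
for a failure. -/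
def pathWeight {K : ℕ} (a b : ℝ) (W : Finset ℕ) (κ : ℕ → Fin K) (x : ℕ → Fin K → Bool)
    (k : Fin K) : ℝ :=
  ∏ s ∈ W, if κ s = k then (if x s k = true then a else b) else 1

/-- The number of slots of `W` in which rate `k` is selected with outcome `o`. -/
def outcomeCount {K : ℕ} (W : Finset ℕ) (κ : ℕ → Fin K) (x : ℕ → Fin K → Bool) (k : Fin K)
    (o : Bool) : ℕ :=
  ((W.filter fun t => κ t = k).filter fun t => x t k = o).card

theorem pathWeight_eq {K : ℕ} (a b : ℝ) (W : Finset ℕ) (κ : ℕ → Fin K) (x : ℕ → Fin K → Bool)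
    (k : Fin K) :
    pathWeight a b W κ x k =
      a ^ outcomeCount W κ x k true * b ^ outcomeCount W κ x k false := by
  unfold pathWeight outcomeCount
  rw [← Finset.prod_filter, Finset.prod_ite]
  simp

theorem outcomeCount_add {K : ℕ} (W : Finset ℕ) (κ : ℕ → Fin K) (x : ℕ → Fin K → Bool)
    (k : Fin K) :
    outcomeCount W κ x k true + outcomeCount W κ x k false = (W.filter fun t => κ t = k).card := by
  unfold outcomeCount
  rw [← Finset.card_filter_add_card_filter_not (s := W.filter fun t => κ t = k)
    (fun t => x t k = true)]
  simp

theorem pathWeight_nonneg {K : ℕ} {a b : ℝ} (ha : 0 ≤ a) (hb : 0 ≤ b) (W : Finset ℕ)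
    (κ : ℕ → Fin K) (x : ℕ → Fin K → Bool) (k : Fin K) : 0 ≤ pathWeight a b W κ x k := by
  rw [pathWeight_eq]; positivity

section Weights

variable {K : ℕ} {Ω : Type*} [mΩ : MeasurableSpace Ω] {P : Measure Ω} [IsProbabilityMeasure P]
  {θ : ℕ → Fin K → ℝ} {ℱ : Filtration ℕ mΩ} {X : ℕ → Ω → Fin K → Bool} {κ : ℕ → Ω → Fin K}

theorem measurable_pathWeight (hX : ∀ t : ℕ, 1 ≤ t → Measurable[ℱ t] (X t))
    (hκ : ∀ t : ℕ, Measurable[ℱ t] (κ (t + 1))) (a b : ℝ) (k : Fin K) (W : Finset ℕ) (N : ℕ)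
    (hW : ∀ s ∈ W, 1 ≤ s ∧ s ≤ N) :
    Measurable[ℱ N] fun ω => pathWeight a b W (fun t => κ t ω) (fun t => X t ω) k := by
  unfold pathWeight
  refine Finset.measurable_fun_prod W fun s hs => ?_
  obtain ⟨h1, h2⟩ := hW s hs
  have hXs : Measurable[ℱ N] (X s) := (hX s h1).mono (ℱ.mono h2) le_rfl
  have hκs : Measurable[ℱ N] (κ s) := by
    obtain ⟨m, rfl⟩ : ∃ m, s = m + 1 := ⟨s - 1, by omega⟩
    exact (hκ m).mono (ℱ.mono (by omega)) le_rfl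
  have hXk : Measurable[ℱ N] fun ω => X s ω k := (measurable_pi_apply k).comp hXs
  refine Measurable.ite (hκs (measurableSet_singleton k)) ?_ measurable_const
  exact Measurable.ite (hXk (measurableSet_singleton true)) measurable_const measurable_const

theorem integrable_pathWeight (hX : ∀ t : ℕ, 1 ≤ t → Measurable[ℱ t] (X t))
    (hκ : ∀ t : ℕ, Measurable[ℱ t] (κ (t + 1))) {a b : ℝ} (ha : 0 ≤ a) (hb : 0 ≤ b) (k : Fin K)
    (W : Finset ℕ) (hW : ∀ s ∈ W, 1 ≤ s) :
    Integrable (fun ω => pathWeight a b W (fun t => κ t ω) (fun t => X t ω) k) P := by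
  have hm := measurable_pathWeight hX hκ a b k W (W.sup id)
    fun s hs => ⟨hW s hs, Finset.le_sup (f := id) hs⟩
  refine Integrable.of_bound (hm.mono (ℱ.le _) le_rfl).aestronglyMeasurable
    (∏ _s ∈ W, (a + b + 1)) (Eventually.of_forall fun ω => ?_)
  rw [Real.norm_of_nonneg (pathWeight_nonneg ha hb _ _ _ _)]
  refine Finset.prod_le_prod (fun s _ => ?_) fun s _ => ?_ <;> split_ifs <;> linarith

/-- The expected weight is at most one when every factor has mean at most one. -/
theorem integral_pathWeight_le_one (hE : IsEnvironment P θ ℱ X)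
    (hκ : ∀ t : ℕ, Measurable[ℱ t] (κ (t + 1))) {a b : ℝ} (ha : 0 ≤ a) (hb : 0 ≤ b) (k : Fin K)
    (W : Finset ℕ) (hW : ∀ s ∈ W, 1 ≤ s ∧ θ s k * a + (1 - θ s k) * b ≤ 1) :
    ∫ ω, pathWeight a b W (fun t => κ t ω) (fun t => X t ω) k ∂P ≤ 1 := by
  induction W using Finset.induction_on_max with
  | empty => simp [pathWeight]
  | insert s W hs ih =>
    have ih := ih fun i hi => hW i (Finset.mem_insert_of_mem hi)
    obtain ⟨hs1, hθ⟩ := hW s (Finset.mem_insert_self s W)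
    have hW1 : ∀ i ∈ W, 1 ≤ i := fun i hi => (hW i (Finset.mem_insert_of_mem hi)).1
    obtain ⟨m, rfl⟩ : ∃ m, s = m + 1 := ⟨s - 1, by omega⟩
    set M : Ω → ℝ := fun ω => pathWeight a b W (fun t => κ t ω) (fun t => X t ω) k with hM
    have hMm : Measurable[ℱ m] M := measurable_pathWeight hE.adapted hκ a b k W m
      fun i hi => ⟨hW1 i hi, by have := hs i hi; omega⟩
    have hMi : Integrable M P := integrable_pathWeight hE.adapted hκ ha hb k W hW1
    have hM0 : ∀ ω, 0 ≤ M ω := fun ω => pathWeight_nonneg ha hb _ _ _ _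
    set A : Set Ω := {ω | κ (m + 1) ω = k} with hA
    have hAm : MeasurableSet[ℱ m] A := hκ m (measurableSet_singleton k)
    have hAm' : MeasurableSet A := ℱ.le m _ hAm
    set Y : Ω → ℝ := fun ω => if X (m + 1) ω k = true then a else b with hY
    have hYm : Measurable[MeasurableSpace.comap (X (m + 1)) inferInstance] Y := by
      have : Measurable fun v : Fin K → Bool => if v k = true then a else b :=
        Measurable.ite ((measurable_pi_apply k : Measurable fun v : Fin K → Bool => v k)
          (measurableSet_singleton true)) measurable_const measurable_const
      exact this.comp (comap_measurable (X (m + 1)))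
    have hXle : MeasurableSpace.comap (X (m + 1)) inferInstance ≤ mΩ :=
      ((hE.adapted (m + 1) (by omega)).mono (ℱ.le _) le_rfl).comap_le
    have hXs : MeasurableSet {ω | X (m + 1) ω k = true} := by
      have : Measurable fun ω => X (m + 1) ω k := (measurable_pi_apply k).comp
        ((hE.adapted (m + 1) (by omega)).mono (ℱ.le _) le_rfl)
      exact this (measurableSet_singleton true)
    have hYint : ∫ ω, Y ω ∂P = θ (m + 1) k * a + (1 - θ (m + 1) k) * b := by
      have h1 : Y = fun ω => b + Set.indicator {ω | X (m + 1) ω k = true} (fun _ => a - b) ω := by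
        funext ω
        by_cases h : X (m + 1) ω k = true <;> simp [hY, Set.indicator, h]
      rw [h1, integral_add (integrable_const _)
        ((integrable_const _).indicator hXs), integral_indicator_const _ hXs,
        hE.mean (m + 1) (by omega) k]
      simp
      ring
    -- The selection in slot m + 1 is already known at time m, so the new outcome is independent
    -- both of the event of selecting `k` and of the earlier weight.
    have hind : IndepFun Y (A.indicator M) P := by
      rw [IndepFun_iff_Indep]
      refine indep_of_indep_of_le_left (indep_of_indep_of_le_right (hE.indep m) ?_) ?_
      · exact (hMm.indicator hAm).comap_le
      · exact hYm.comap_le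
    have hprod : ∫ ω, Y ω * A.indicator M ω ∂P = (∫ ω, Y ω ∂P) * ∫ ω, A.indicator M ω ∂P :=
      hind.integral_fun_mul_eq_mul_integral (hYm.mono hXle le_rfl).aestronglyMeasurable
        ((hMm.indicator hAm).mono (ℱ.le _) le_rfl).aestronglyMeasurable
    have hYA : Integrable (fun ω => Y ω * A.indicator M ω) P := by
      refine (hMi.indicator hAm').bdd_mul (c := a + b)
        (hYm.mono hXle le_rfl).aestronglyMeasurable (Eventually.of_forall fun ω => ?_)
      simp only [hY]
      split_ifs
      · rw [Real.norm_of_nonneg ha]; linarith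
      · rw [Real.norm_of_nonneg hb]; linarith
    have hsplit : ∀ ω, pathWeight a b (insert (m + 1) W) (fun t => κ t ω) (fun t => X t ω) k =
        Y ω * A.indicator M ω + Aᶜ.indicator M ω := by
      intro ω
      rw [pathWeight, Finset.prod_insert fun h => lt_irrefl _ (hs _ h)]
      by_cases h : κ (m + 1) ω = k
      · simp [A, Set.indicator, h, hY, hM, pathWeight]
      · simp [A, Set.indicator, h, hM, pathWeight]
    calc _ = ∫ ω, Y ω * A.indicator M ω + Aᶜ.indicator M ω ∂P := by simp_rw [hsplit]
      _ = (∫ ω, Y ω ∂P) * ∫ ω, A.indicator M ω ∂P + ∫ ω, Aᶜ.indicator M ω ∂P := by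
        rw [integral_add hYA (hMi.indicator hAm'.compl), hprod]
      _ ≤ 1 * ∫ ω, A.indicator M ω ∂P + ∫ ω, Aᶜ.indicator M ω ∂P := by
        gcongr
        · exact integral_nonneg fun ω => Set.indicator_nonneg (fun ω _ => hM0 ω) ω
        · rw [hYint]; exact hθ
      _ = ∫ ω, M ω ∂P := by
        rw [one_mul, ← integral_add (hMi.indicator hAm') (hMi.indicator hAm'.compl)]
        congr 1
        funext ω
        exact congrFun (Set.indicator_self_add_compl A M) ω
      _ ≤ 1 := ih

end Weights

/-! ### Sample paths of the index policy -/

theorem mem_window {τ : ℝ} {n t : ℕ} :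
    t ∈ window τ n ↔ (1 ≤ t ∧ t < n) ∧ (n : ℝ) - τ ≤ (t : ℝ) := by
  simp [window]

theorem pulls_eq_outcomeCount_add {K : ℕ} (τ : ℝ) (κ : ℕ → Fin K) (x : ℕ → Fin K → Bool) (n : ℕ)
    (k : Fin K) :
    pulls τ κ n k = outcomeCount (window τ n) κ x k true + outcomeCount (window τ n) κ x k false :=
  (outcomeCount_add _ _ _ _).symm

theorem empiricalReward_div {K : ℕ} {r : Fin K → ℝ} (τ : ℝ) (κ : ℕ → Fin K)
    (x : ℕ → Fin K → Bool) (n : ℕ) {k : Fin K} (hr : 0 < r k) :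
    empiricalReward r τ κ x n k / r k =
      (outcomeCount (window τ n) κ x k true : ℝ) / (pulls τ κ n k : ℝ) := by
  unfold empiricalReward outcomeCount
  rw [← Finset.mul_sum, Finset.sum_boole, div_right_comm, mul_div_cancel_left₀ _ hr.ne']

theorem pulls_le_floor {K : ℕ} {τ : ℝ} (hτ : 0 ≤ τ) (κ : ℕ → Fin K) (n : ℕ) (k : Fin K) :
    pulls τ κ n k ≤ ⌊τ⌋₊ := by
  have h : window τ n ⊆ Finset.Ico (n - ⌊τ⌋₊) n := by
    intro t ht
    rw [mem_window] at ht
    obtain ⟨⟨-, h2⟩, h3⟩ := ht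
    rw [Finset.mem_Ico]
    have : n - t ≤ ⌊τ⌋₊ := by
      rw [Nat.le_floor_iff hτ, Nat.cast_sub h2.le]
      linarith
    omega
  calc pulls τ κ n k ≤ (window τ n).card := Finset.card_filter_le _ _
    _ ≤ _ := Finset.card_le_card h
    _ ≤ ⌊τ⌋₊ := by rw [Nat.card_Ico]; omega

section Index

variable {K : ℕ} {r : Fin K → ℝ} {c τ : ℝ} {κ : ℕ → Fin K} {x : ℕ → Fin K → Bool} {n : ℕ}
  {k : Fin K}

theorem klIndex_nonneg : 0 ≤ klIndex r c τ κ x n k :=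
  Real.sSup_nonneg fun _ hq => hq.1

theorem le_klIndex {q : ℝ} (h0 : 0 ≤ q) (h1 : q ≤ r k)
    (h : (((pulls τ κ n k : ℕ) : ℝ) : EReal) *
        bernoulliKL (empiricalReward r τ κ x n k / r k) (q / r k) ≤
      ((Real.log τ + c * Real.log (Real.log τ) : ℝ) : EReal)) :
    q ≤ klIndex r c τ κ x n k :=
  le_csSup ⟨r k, fun _ hq => hq.2.1⟩ ⟨h0, h1, h⟩

/-- Values at or above `p` are infeasible for the index. Infeasibility of `p` is the divergence
bound; the empirical mean is always feasible, having divergence 0 from itself, so it lies below `p`.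
-/
theorem sample_of_klIndex_lt {p : ℝ} (hr : 0 < r k) (hp : 0 < p) (hp1 : p < 1)
    (hf : 0 ≤ Real.log τ + c * Real.log (Real.log τ))
    (h : klIndex r c τ κ x n k < r k * p) {S F : ℕ}
    (hS : S = outcomeCount (window τ n) κ x k true)
    (hF : F = outcomeCount (window τ n) κ x k false) :
    (S : ℝ) < (S + F) * p ∧ Real.log τ + c * Real.log (Real.log τ) <
      (S + F) * ((S : ℝ) / (S + F) * Real.log ((S : ℝ) / (S + F) / p) +
        (1 - (S : ℝ) / (S + F)) * Real.log ((1 - (S : ℝ) / (S + F)) / (1 - p))) := by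
  have hx : empiricalReward r τ κ x n k / r k = (S : ℝ) / (S + F) := by
    rw [empiricalReward_div τ κ x n hr, pulls_eq_outcomeCount_add τ κ x n k, ← hS, ← hF]
    push_cast; rfl
  have ht : ((pulls τ κ n k : ℕ) : ℝ) = S + F := by
    rw [pulls_eq_outcomeCount_add τ κ x n k, ← hS, ← hF]; push_cast; rfl
  have h1 : ∀ q : ℝ, 0 ≤ q → q ≤ 1 → p ≤ q →
      ¬ (((S + F : ℝ) : EReal) * bernoulliKL ((S : ℝ) / (S + F)) q ≤
        ((Real.log τ + c * Real.log (Real.log τ) : ℝ) : EReal)) := by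
    intro q hq0 hq1 hpq hle
    have := le_klIndex (r := r) (c := c) (τ := τ) (κ := κ) (x := x) (n := n) (k := k)
      (q := r k * q) (by positivity) (by nlinarith)
      (by rw [hx, ht, mul_div_cancel_left₀ _ hr.ne']; exact hle)
    nlinarith
  have hp' := h1 p hp.le hp1.le le_rfl
  rw [bernoulliKL_eq_coe hp hp1, ← EReal.coe_mul, EReal.coe_le_coe_iff, not_le] at hp'
  refine ⟨?_, hp'⟩
  by_contra hcon
  push Not at hcon
  have h0 : (0 : ℝ) < S + F := by
    rcases (by positivity : (0 : ℝ) ≤ (S : ℝ) + F).eq_or_lt with h0 | h0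
    · rw [← h0] at hp'; linarith
    · exact h0
  refine h1 ((S : ℝ) / (S + F)) (by positivity) ?_ ?_ ?_
  · rw [div_le_one h0]
    have : (0 : ℝ) ≤ F := by positivity
    linarith
  · rw [le_div_iff₀ h0]; linarith
  · rw [bernoulliKL_self, mul_zero]
    exact_mod_cast hf

/-- By the Pinsker-type bound, with this many pulls every feasible value is within `η` of the
empirical mean, so a large index forces a large empirical mean. -/
theorem sample_of_lt_klIndex {q η : ℝ} (hr : 0 < r k) (hq : 0 ≤ q) (hη : 0 < η)
    (hf : 0 < Real.log τ + c * Real.log (Real.log τ))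
    (hm : 4 * (Real.log τ + c * Real.log (Real.log τ)) / η ^ 2 ≤ pulls τ κ n k)
    (h : r k * q < klIndex r c τ κ x n k) :
    (q - η) * (pulls τ κ n k : ℝ) ≤ outcomeCount (window τ n) κ x k true := by
  have hne : {q : ℝ | 0 ≤ q ∧ q ≤ r k ∧
      (((pulls τ κ n k : ℕ) : ℝ) : EReal) *
        bernoulliKL (empiricalReward r τ κ x n k / r k) (q / r k) ≤
      ((Real.log τ + c * Real.log (Real.log τ) : ℝ) : EReal)}.Nonempty := by
    -- The supremum of the empty set is 0, which cannot exceed `r k * q`.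
    by_contra hcon
    rw [Set.not_nonempty_iff_eq_empty] at hcon
    rw [klIndex, hcon, Real.sSup_empty] at h
    have : 0 ≤ r k * q := by positivity
    linarith
  obtain ⟨q', ⟨hq0, hq1, hle⟩, hlt⟩ := exists_lt_of_lt_csSup hne h
  set f := Real.log τ + c * Real.log (Real.log τ) with hfdef
  have ht : (0 : ℝ) < pulls τ κ n k := lt_of_lt_of_le (by positivity) hm
  have hcount := pulls_eq_outcomeCount_add τ κ x n k
  rw [empiricalReward_div τ κ x n hr] at hle
  set S := outcomeCount (window τ n) κ x k true
  set t := pulls τ κ n k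
  have hS : (S : ℝ) ≤ t := by exact_mod_cast (by omega : S ≤ t)
  have h1 := half_sq_sub_le_of_mul_bernoulliKL_le (by positivity) ((div_le_one ht).mpr hS)
    (by positivity) ((div_le_one hr).mpr hq1) hle
  have h2 : 4 * f ≤ t * η ^ 2 := by rwa [div_le_iff₀ (by positivity)] at hm
  have h3 : ((S : ℝ) / t - q' / r k) ^ 2 ≤ η ^ 2 := by
    have : (t : ℝ) * (((S : ℝ) / t - q' / r k) ^ 2) ≤ t * η ^ 2 := by linarith
    exact le_of_mul_le_mul_left this ht
  have h4 := (abs_le_of_sq_le_sq' h3 hη.le).1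
  have h5 : q < q' / r k := by rw [lt_div_iff₀ hr]; linarith
  have h6 : q - η ≤ (S : ℝ) / t := by linarith
  rwa [le_div_iff₀ ht] at h6

end Index

/-- A rate is selected at most `N` times per window length while it has fewer than `N` selections
in the current window. -/
theorem card_underexplored_le {K : ℕ} {τ : ℝ} (hτ : 1 ≤ τ) (κ : ℕ → Fin K) (k : Fin K)
    (N T : ℕ) :
    ((Finset.Icc 1 T).filter fun n => κ n = k ∧ pulls τ κ n k < N).card ≤
      N * (T / ⌊τ⌋₊ + 1) := by
  classical
  have hL : 0 < ⌊τ⌋₊ := Nat.floor_pos.mpr hτ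
  rw [← Finset.card_range (T / ⌊τ⌋₊ + 1)]
  refine Finset.card_le_mul_card_image_of_maps_to (f := fun n => n / ⌊τ⌋₊) ?_ N ?_
  · intro n hn
    simp only [Finset.mem_filter, Finset.mem_Icc] at hn
    have := Nat.div_le_div_right (c := ⌊τ⌋₊) hn.1.2
    simp only [Finset.mem_range]
    omega
  · intro i _
    set B := ((Finset.Icc 1 T).filter fun n => κ n = k ∧ pulls τ κ n k < N).filter
      fun n => n / ⌊τ⌋₊ = i with hB
    rcases B.eq_empty_or_nonempty with h | hne
    · simp [h]
    · obtain ⟨n, hn, hmax⟩ := B.exists_max_image id hne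
      have hn' := hn
      simp only [hB, Finset.mem_filter, Finset.mem_Icc] at hn'
      obtain ⟨⟨⟨h1, h2⟩, h3, h4⟩, h5⟩ := hn'
      have hsub : B.erase n ⊆ (window τ n).filter fun t => κ t = k := by
        intro t ht
        obtain ⟨hne, ht⟩ := Finset.mem_erase.mp ht
        have hle := hmax t ht
        simp only [hB, Finset.mem_filter, Finset.mem_Icc] at ht
        obtain ⟨⟨⟨g1, g2⟩, g3, -⟩, g5⟩ := ht
        simp only [id] at hle
        refine Finset.mem_filter.mpr ⟨mem_window.mpr ⟨⟨g1, by omega⟩, ?_⟩, g3⟩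
        have e1 := Nat.div_add_mod n ⌊τ⌋₊
        have e2 := Nat.div_add_mod t ⌊τ⌋₊
        have e3 := Nat.mod_lt n hL
        rw [h5] at e1
        rw [g5] at e2
        have e4 : n ≤ t + ⌊τ⌋₊ := by omega
        have e5 : (n : ℝ) ≤ t + (⌊τ⌋₊ : ℝ) := by exact_mod_cast e4
        have := Nat.floor_le (zero_le_one.trans hτ)
        linarith
      have hc := Finset.card_le_card hsub
      rw [Finset.card_erase_of_mem hn] at hc
      change _ ≤ pulls τ κ n k at hc
      omega

/-- If some suboptimal rate is within `Δ` of the optimum, then some pair of neighbours is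
within `Δ`. -/
theorem one_le_sum_close {K : ℕ} {r η : Fin K → ℝ} (hr : ∀ k, 0 < r k) (hu : WeaklyUnimodal r η)
    {k j : Fin K} {Δ : ℝ} (hj : ∀ i, r i * η i ≤ r j * η j) (hlt : r k * η k < r j * η j)
    (hle : r j * η j - r k * η k ≤ Δ) :
    1 ≤ ∑ k : Fin K, ∑ l ∈ neighbors r η k,
      if |r k * η k - r l * η l| ≤ Δ then (1 : ℝ) else 0 := by
  obtain ⟨h01, s, hmono, hanti⟩ := hu
  have hmax : ∀ i, r i * η i ≤ r s * η s := fun i => by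
    rcases le_total i s with h | h
    · exact hmono (Set.mem_Iic.mpr h) (Set.mem_Iic.mpr le_rfl) h
    · exact hanti (Set.mem_Ici.mpr le_rfl) (Set.mem_Ici.mpr h) h
  -- `l` is the neighbour of `k` on the side of the peak; `k` is not the peak because it is
  -- suboptimal.
  obtain ⟨l, hadj, hkl⟩ : ∃ l : Fin K, ((l : ℕ) + 1 = (k : ℕ) ∨ (l : ℕ) = (k : ℕ) + 1) ∧
      r k * η k ≤ r l * η l := by
    have hks : k ≠ s := fun h => by subst h; exact absurd (hmax j) (not_le.mpr hlt)
    rcases lt_or_gt_of_ne hks with h | h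
    · have hv : (k : ℕ) < s := h
      exact ⟨⟨k + 1, by omega⟩, Or.inr rfl, hmono (Set.mem_Iic.mpr h.le)
        (Set.mem_Iic.mpr (Fin.le_def.mpr (by simp; omega))) (Fin.le_def.mpr (by simp))⟩
    · have hv : (s : ℕ) < k := h
      exact ⟨⟨k - 1, by omega⟩, Or.inl (by simp; omega),
        hanti (Set.mem_Ici.mpr (Fin.le_def.mpr (by simp; omega))) (Set.mem_Ici.mpr h.le)
        (Fin.le_def.mpr (by simp))⟩
  have hlj : r l * η l - r k * η k ≤ Δ := by linarith [hj l]
  have hlN : l ∈ neighbors r η k := by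
    simp only [neighbors, Finset.mem_filter, Finset.mem_univ, true_and]
    exact ⟨hadj, hkl.trans (mul_le_of_le_one_right (hr l).le (h01 l).2)⟩
  have h0 : ∀ (k l : Fin K), (0 : ℝ) ≤ if |r k * η k - r l * η l| ≤ Δ then (1 : ℝ) else 0 :=
    fun k l => by split_ifs <;> norm_num
  calc (1 : ℝ) = if |r k * η k - r l * η l| ≤ Δ then (1 : ℝ) else 0 := by
        rw [if_pos]; rw [abs_sub_comm, abs_of_nonneg (by linarith)]; exact hlj
    _ ≤ ∑ l ∈ neighbors r η k, if |r k * η k - r l * η l| ≤ Δ then (1 : ℝ) else 0 :=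
        Finset.single_le_sum (f := fun l => if |r k * η k - r l * η l| ≤ Δ then (1 : ℝ) else 0)
          (fun l _ => h0 k l) hlN
    _ ≤ _ := Finset.single_le_sum (f := fun k => ∑ l ∈ neighbors r η k,
          if |r k * η k - r l * η l| ≤ Δ then (1 : ℝ) else 0)
          (fun k _ => Finset.sum_nonneg fun l _ => h0 k l) (Finset.mem_univ k)

/-! ### Deviation events -/

section Deviation

variable {K : ℕ} {Ω : Type*} [mΩ : MeasurableSpace Ω] {P : Measure Ω} [IsProbabilityMeasure P]
  {θ : ℕ → Fin K → ℝ} {ℱ : Filtration ℕ mΩ} {X : ℕ → Ω → Fin K → Bool} {κ : ℕ → Ω → Fin K}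
  {r : Fin K → ℝ} {c τ σ : ℝ}

theorem abs_drift_le_of_mem_window (hσ : 0 ≤ σ) (hθ : LipschitzDrift σ θ) {n s : ℕ}
    (hn : 1 ≤ n) (hs : s ∈ window τ n) (k : Fin K) : |θ s k - θ n k| ≤ σ * τ := by
  rw [mem_window] at hs
  have hsn : (s : ℝ) ≤ n := by exact_mod_cast hs.1.2.le
  refine (hθ k n s hn hs.1.1).trans (mul_le_mul_of_nonneg_left ?_ hσ)
  rw [abs_sub_comm, abs_of_nonneg (by linarith)]
  linarith [hs.2]

/-- The index of a rate rarely falls below the smallest throughput of that rate over the window. -/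
theorem exists_dominating_of_klIndex_lt (hr : ∀ k, 0 < r k) (hσ : 0 < σ) (hτ : 1 ≤ τ)
    (hθ : LipschitzDrift σ θ) (h01 : ∀ t, 1 ≤ t → ∀ k, 0 ≤ θ t k ∧ θ t k ≤ 1)
    (hE : IsEnvironment P θ ℱ X) (hκ : ∀ t : ℕ, Measurable[ℱ t] (κ (t + 1)))
    (hf : 0 ≤ Real.log τ + c * Real.log (Real.log τ)) {J : ℕ} (hJ : ⌊τ⌋₊ < 2 ^ J)
    {n : ℕ} (hn : 1 ≤ n) (k : Fin K) :
    ∃ G : Ω → ℝ, Integrable G P ∧ (∀ ω, 0 ≤ G ω) ∧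
      ∫ ω, G ω ∂P ≤ J * Real.exp (-((Real.log τ + c * Real.log (Real.log τ)) / 2)) ∧
      ∀ ω, klIndex r c τ (fun t => κ t ω) (fun t => X t ω) n k < r k * (θ n k - σ * τ) →
        1 ≤ G ω := by
  set f := Real.log τ + c * Real.log (Real.log τ) with hfdef
  have hστ : 0 < σ * τ := by positivity
  rcases le_or_gt (θ n k - σ * τ) 0 with hp | hp
  · refine ⟨fun _ => 0, integrable_zero _ _ _, fun _ => le_rfl, by simp; positivity, ?_⟩
    intro ω h
    exact absurd (h.trans_le (mul_nonpos_of_nonneg_of_nonpos (hr k).le hp))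
      (not_lt.mpr klIndex_nonneg)
  set p := θ n k - σ * τ with hpdef
  have hp1 : p < 1 := by linarith [(h01 n hn k).2]
  -- Peeling: one alternative for each dyadic range of the number of pulls.
  choose z hz0 hzp hz using fun j : ℕ => exists_likelihoodRatio_bound hp hp1 hf (2 ^ j)
  have ha (j : ℕ) : 0 ≤ z j / p := div_nonneg (hz0 j) hp.le
  have hb (j : ℕ) : 0 ≤ (1 - z j) / (1 - p) :=
    div_nonneg (by linarith [hzp j]) (by linarith)
  set w : ℕ → Ω → ℝ := fun j ω => pathWeight (z j / p) ((1 - z j) / (1 - p)) (window τ n)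
    (fun t => κ t ω) (fun t => X t ω) k with hw
  have hW1 : ∀ s ∈ window τ n, 1 ≤ s := fun s hs => (mem_window.mp hs).1.1
  have hwi (j : ℕ) : Integrable (w j) P :=
    integrable_pathWeight hE.adapted hκ (ha j) (hb j) k _ hW1
  have hw0 (j : ℕ) (ω : Ω) : 0 ≤ w j ω := pathWeight_nonneg (ha j) (hb j) _ _ _ _
  have hwle (j : ℕ) : ∫ ω, w j ω ∂P ≤ 1 := by
    refine integral_pathWeight_le_one hE hκ (ha j) (hb j) k _ fun s hs => ⟨hW1 s hs, ?_⟩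
    have hd := (abs_le.mp (abs_drift_le_of_mem_window hσ.le hθ hn hs k)).1
    have h1 : z j / p ≤ (1 - z j) / (1 - p) := by
      rw [div_le_div_iff₀ hp (by linarith)]; nlinarith [hzp j]
    have h2 : p * (z j / p) + (1 - p) * ((1 - z j) / (1 - p)) = 1 := by
      rw [mul_div_cancel₀ _ hp.ne', mul_div_cancel₀ _ (by linarith : (1 : ℝ) - p ≠ 0)]; ring
    -- The factor has mean exactly 1 under `p`; since `z j ≤ p`, a larger success probability only
    -- lowers the mean.
    nlinarith [mul_nonneg (by linarith : 0 ≤ θ s k - p) (sub_nonneg.mpr h1)]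
  -- Markov's inequality in dominating form: the deviation event itself need not be shown
  -- measurable.
  refine ⟨fun ω => Real.exp (-(f / 2)) * ∑ j ∈ Finset.range J, w j ω,
    (integrable_finsetSum _ fun j _ => hwi j).const_mul _,
    fun ω => mul_nonneg (Real.exp_pos _).le (Finset.sum_nonneg fun j _ => hw0 j ω), ?_, ?_⟩
  · rw [integral_const_mul, integral_finsetSum _ fun j _ => hwi j, mul_comm]
    refine mul_le_mul_of_nonneg_right ?_ (Real.exp_pos _).le
    calc _ ≤ ∑ j ∈ Finset.range J, (1 : ℝ) := Finset.sum_le_sum fun j _ => hwle j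
      _ = J := by simp
  · intro ω h
    obtain ⟨h1, h2⟩ := sample_of_klIndex_lt (hr k) hp hp1 hf h rfl rfl
    have hcount := pulls_eq_outcomeCount_add τ (fun t => κ t ω) (fun t => X t ω) n k
    have hle := pulls_le_floor (zero_le_one.trans hτ) (fun t => κ t ω) n k
    set S := outcomeCount (window τ n) (fun t => κ t ω) (fun t => X t ω) k true
    set F := outcomeCount (window τ n) (fun t => κ t ω) (fun t => X t ω) k false
    have hne : S + F ≠ 0 := by
      intro h0
      have : (S : ℝ) + F = 0 := by exact_mod_cast h0
      rw [this] at h1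
      have : (0 : ℝ) ≤ S := by positivity
      linarith
    have hj1 := Nat.pow_log_le_self 2 hne
    have hj2 := Nat.lt_pow_succ_log_self (b := 2) (by norm_num) (S + F)
    have hjJ : Nat.log 2 (S + F) < J := by
      by_contra hcon
      have := Nat.pow_le_pow_right (n := 2) (by norm_num) (not_lt.mp hcon)
      omega
    have h3 := hz (Nat.log 2 (S + F)) S F hj1 (by rw [pow_succ] at hj2; omega) h1 h2
    have h4 : Real.exp (f / 2) ≤ ∑ j ∈ Finset.range J, w j ω := by
      refine le_trans ?_ (Finset.single_le_sum (f := fun j => w j ω) (fun j _ => hw0 j ω)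
        (Finset.mem_range.mpr hjJ))
      simp only [hw, pathWeight_eq]
      exact h3
    calc (1 : ℝ) = Real.exp (-(f / 2)) * Real.exp (f / 2) := by rw [← Real.exp_add]; simp
      _ ≤ _ := mul_le_mul_of_nonneg_left h4 (Real.exp_pos _).le

/-- A rate selected often in the window rarely has an empirical success rate that exceeds its
success probabilities over the window by `η`. -/
theorem exists_dominating_of_le_outcomeCount (hσ : 0 ≤ σ)
    (hθ : LipschitzDrift σ θ) (h01 : ∀ t, 1 ≤ t → ∀ k, 0 ≤ θ t k ∧ θ t k ≤ 1)
    (hE : IsEnvironment P θ ℱ X) (hκ : ∀ t : ℕ, Measurable[ℱ t] (κ (t + 1)))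
    {f η : ℝ} (hη : 0 < η) (hη1 : η ≤ 1) {n : ℕ} (hn : 1 ≤ n) (k : Fin K) :
    ∃ G : Ω → ℝ, Integrable G P ∧ (∀ ω, 0 ≤ G ω) ∧ ∫ ω, G ω ∂P ≤ Real.exp (-f) ∧
      ∀ ω, 4 * f / η ^ 2 ≤ pulls τ (fun t => κ t ω) n k →
        (θ n k + σ * τ + η) * (pulls τ (fun t => κ t ω) n k : ℝ) ≤
          outcomeCount (window τ n) (fun t => κ t ω) (fun t => X t ω) k true → 1 ≤ G ω := by
  set p := θ n k + σ * τ with hp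
  -- This `l` maximizes l η - l², giving η² / 4 per pull; hence the threshold 4 f / η².
  set l := η / 2 with hl
  have hl0 : 0 < l := by positivity
  set d := -(l * p) - l ^ 2 with hd
  have ha : 0 ≤ Real.exp (l + d) := (Real.exp_pos _).le
  have hb : 0 ≤ Real.exp d := (Real.exp_pos _).le
  set w : Ω → ℝ := fun ω => pathWeight (Real.exp (l + d)) (Real.exp d) (window τ n)
    (fun t => κ t ω) (fun t => X t ω) k with hw
  have hW1 : ∀ s ∈ window τ n, 1 ≤ s := fun s hs => (mem_window.mp hs).1.1
  have hwi : Integrable w P := integrable_pathWeight hE.adapted hκ ha hb k _ hW1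
  have hwle : ∫ ω, w ω ∂P ≤ 1 := by
    refine integral_pathWeight_le_one hE hκ ha hb k _ fun s hs => ⟨hW1 s hs, ?_⟩
    have hdr := (abs_le.mp (abs_drift_le_of_mem_window hσ hθ hn hs k)).2
    obtain ⟨hs0, hs1⟩ := h01 s (hW1 s hs) k
    have hexp : Real.exp l ≤ 1 + l + l ^ 2 := by
      have := (abs_le.mp (Real.abs_exp_sub_one_sub_id_le (x := l)
        (by rw [abs_of_pos hl0]; linarith))).2
      linarith
    have h1 : θ s k * Real.exp l + (1 - θ s k) ≤ Real.exp (-d) := by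
      have h2 : θ s k * Real.exp l ≤ θ s k * (1 + l + l ^ 2) :=
        mul_le_mul_of_nonneg_left hexp hs0
      have h3 := Real.add_one_le_exp (-d)
      have h4 : θ s k * l ≤ p * l := mul_le_mul_of_nonneg_right (by linarith) hl0.le
      have h5 : θ s k * l ^ 2 ≤ 1 * l ^ 2 := mul_le_mul_of_nonneg_right hs1 (by positivity)
      have h6 : -d = l * p + l ^ 2 := by rw [hd]; ring
      rw [h6] at h3 ⊢
      linarith
    calc θ s k * Real.exp (l + d) + (1 - θ s k) * Real.exp d
        = (θ s k * Real.exp l + (1 - θ s k)) * Real.exp d := by rw [Real.exp_add]; ring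
      _ ≤ Real.exp (-d) * Real.exp d := mul_le_mul_of_nonneg_right h1 hb
      _ = 1 := by rw [← Real.exp_add]; simp
  refine ⟨fun ω => Real.exp (-f) * w ω, hwi.const_mul _,
    fun ω => mul_nonneg (Real.exp_pos _).le (pathWeight_nonneg ha hb _ _ _ _), ?_, ?_⟩
  · rw [integral_const_mul]
    exact mul_le_of_le_one_right (Real.exp_pos _).le hwle
  · intro ω hm hS
    have hcount := pulls_eq_outcomeCount_add τ (fun t => κ t ω) (fun t => X t ω) n k
    simp only [hw, pathWeight_eq]
    set S := outcomeCount (window τ n) (fun t => κ t ω) (fun t => X t ω) k true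
    set F := outcomeCount (window τ n) (fun t => κ t ω) (fun t => X t ω) k false
    have ht : (pulls τ (fun t => κ t ω) n k : ℝ) = S + F := by rw [hcount]; push_cast; rfl
    rw [ht] at hm hS
    rw [div_le_iff₀ (by positivity)] at hm
    rw [← Real.exp_nat_mul, ← Real.exp_nat_mul, ← Real.exp_add, ← Real.exp_add,
      Real.one_le_exp_iff]
    have h1 := mul_le_mul_of_nonneg_left hS hl0.le
    have h2 : (S : ℝ) * (l + d) + F * d = l * S - (S + F) * (l * p + l ^ 2) := by rw [hd]; ring
    rw [h2]
    have h3 : η = 2 * l := by rw [hl]; ring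
    rw [h3] at hm h1
    nlinarith

end Deviation

/-! ### The regret over a finite horizon -/

/-- A bound on the regret in one slot, given the outcomes of the deviation events. -/
theorem gap_le_of_follows {K : ℕ} {r : Fin K → ℝ} {c τ σ η R : ℝ} {θ : Fin K → ℝ}
    {κ : ℕ → Fin K} {x : ℕ → Fin K → Bool} (hr : ∀ k, 0 < r k) (hR : ∀ k, r k ≤ R)
    (hη : 0 < η) (hστ : σ * τ ≤ η) (hστ0 : 0 ≤ σ * τ)
    (hf : 0 < Real.log τ + c * Real.log (Real.log τ))
    (h01 : ∀ k, 0 ≤ θ k ∧ θ k ≤ 1) {n : ℕ} {j : Fin K}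
    (hfol : klIndex r c τ κ x n j ≤ klIndex r c τ κ x n (κ n))
    (hopt : r j * (θ j - σ * τ) ≤ klIndex r c τ κ x n j)
    (hm : 4 * (Real.log τ + c * Real.log (Real.log τ)) / η ^ 2 ≤ pulls τ κ n (κ n))
    (hdev : ¬ (θ (κ n) + σ * τ + η) * (pulls τ κ n (κ n) : ℝ) ≤
      outcomeCount (window τ n) κ x (κ n) true) :
    r j * θ j - r (κ n) * θ (κ n) ≤ 8 * R * η := by
  by_contra hcon
  push Not at hcon
  set k := κ n
  have hR0 : 0 < R := (hr k).trans_le (hR k)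
  have h1 : r j * (σ * τ) ≤ R * η := mul_le_mul (hR j) hστ hστ0 hR0.le
  -- The selected index is at least r_j θ_j - Rη, and the left side is at most r_k θ_k + 3Rη; a gap
  -- of 8Rη is more than enough.
  have h2 : r k * (θ k + σ * τ + 2 * η) < klIndex r c τ κ x n k := by
    have h3 : r k * (σ * τ) ≤ R * η := mul_le_mul (hR k) hστ hστ0 hR0.le
    have h4 : r k * η ≤ R * η := mul_le_mul_of_nonneg_right (hR k) hη.le
    have h5 : 0 < R * η := by positivity
    nlinarith
  have h3 := sample_of_lt_klIndex (hr k) (by linarith [(h01 k).1]) hη hf hm h2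
  refine hdev (le_trans (mul_le_mul_of_nonneg_right ?_ (Nat.cast_nonneg _)) h3)
  linarith

/-- The deviation below is needed only for the deterministic best rate, but the deviation above for
all `K` rates, since the selected one is random. -/
theorem regret_le {K : ℕ} [NeZero K] {Ω : Type*} [mΩ : MeasurableSpace Ω] {P : Measure Ω}
    [IsProbabilityMeasure P] {θ : ℕ → Fin K → ℝ} {ℱ : Filtration ℕ mΩ}
    {X : ℕ → Ω → Fin K → Bool} {κ : ℕ → Ω → Fin K} {r : Fin K → ℝ} {c τ σ η R : ℝ}
    (hr : ∀ k, 0 < r k) (hR : ∀ k, r k ≤ R) (hσ : 0 < σ) (hτ : 1 ≤ τ)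
    (hθ : LipschitzDrift σ θ) (hu : ∀ t, 1 ≤ t → WeaklyUnimodal r (θ t))
    (hE : IsEnvironment P θ ℱ X) (hA : IsSWKLRUCB P r c τ ℱ X κ)
    (hf : 0 < Real.log τ + c * Real.log (Real.log τ)) {J : ℕ} (hJ : ⌊τ⌋₊ < 2 ^ J)
    (hη : 0 < η) (hη1 : η ≤ 1) (hστ : σ * τ ≤ η) (T : ℕ) :
    regret P r θ κ T ≤ K * R + 8 * R * η * closeCount r θ (8 * R * η) T +
      R * (T * (J * Real.exp (-((Real.log τ + c * Real.log (Real.log τ)) / 2)) +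
          K * Real.exp (-(Real.log τ + c * Real.log (Real.log τ)))) +
        K * (⌈4 * (Real.log τ + c * Real.log (Real.log τ)) / η ^ 2⌉₊ *
          (T / ⌊τ⌋₊ + 1 : ℕ))) := by
  classical
  have h01 : ∀ t, 1 ≤ t → ∀ k, 0 ≤ θ t k ∧ θ t k ≤ 1 := fun t ht => (hu t ht).1
  set f := Real.log τ + c * Real.log (Real.log τ) with hfdef
  set N := ⌈4 * f / η ^ 2⌉₊ with hN
  have hR0 : 0 < R := (hr 0).trans_le (hR 0)
  have hsup (n : ℕ) : ∃ j, r j * θ n j = ⨆ k, r k * θ n k := exists_eq_ciSup_of_finite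
  choose j hj using hsup
  have hjmax (n : ℕ) (i : Fin K) : r i * θ n i ≤ r (j n) * θ n (j n) := by
    rw [hj n]; exact le_ciSup (f := fun k => r k * θ n k) (Set.finite_range _).bddAbove i
  have hG1 (n : ℕ) := fun hn : 1 ≤ n =>
    exists_dominating_of_klIndex_lt hr hσ hτ hθ h01 hE hA.predictable hf.le hJ hn (j n)
  have hG2 (n : ℕ) := fun (hn : 1 ≤ n) (k : Fin K) =>
    exists_dominating_of_le_outcomeCount (τ := τ) hσ.le hθ h01 hE hA.predictable (f := f) hη hη1
      hn k
  choose! G1 hG1i hG10 hG1le hG1 using hG1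
  choose! G2 hG2i hG20 hG2le hG2 using hG2
  set gap : ℕ → Fin K → ℝ := fun n k => (⨆ k, r k * θ n k) - r k * θ n k with hgap
  have hgap0 (n : ℕ) (k : Fin K) : 0 ≤ gap n k := by
    simp only [hgap, ← hj n]; linarith [hjmax n k]
  have hgapR (n : ℕ) (hn : 1 ≤ n) (k : Fin K) : gap n k ≤ R := by
    simp only [hgap, ← hj n]
    have h1 : r (j n) * θ n (j n) ≤ r (j n) * 1 :=
      mul_le_mul_of_nonneg_left (h01 n hn (j n)).2 (hr _).le
    have h2 : 0 ≤ r k * θ n k := mul_nonneg (hr k).le (h01 n hn k).1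
    linarith [hR (j n)]
  set h : ℕ → ℝ := fun n => ∑ k : Fin K, ∑ l ∈ neighbors r (θ n) k,
      if |r k * θ n k - r l * θ n l| ≤ 8 * R * η then (1 : ℝ) else 0 with hh
  have hh0 (n : ℕ) : 0 ≤ h n := Finset.sum_nonneg fun k _ => Finset.sum_nonneg fun l _ => by
    split_ifs <;> norm_num
  set U : ℕ → Fin K → Ω → ℝ := fun n k ω =>
    if κ n ω = k ∧ pulls τ (fun t => κ t ω) n k < N then 1 else 0 with hU
  have hU0 (n : ℕ) (k : Fin K) (ω : Ω) : 0 ≤ U n k ω := by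
    simp only [hU]; split_ifs <;> norm_num
  have hpt : ∀ᵐ ω ∂P, ∀ n ∈ Finset.Icc 1 T, gap n (κ n ω) ≤
      R * (if n ≤ K then 1 else 0) + 8 * R * η * h n +
        R * (G1 n ω + ∑ k, G2 n k ω + ∑ k, U n k ω) := by
    filter_upwards [hA.follows] with ω hω n hn
    have hn1 : 1 ≤ n := (Finset.mem_Icc.mp hn).1
    have hg1 := hG10 n hn1 ω
    have hg2 : 0 ≤ ∑ k, G2 n k ω := Finset.sum_nonneg fun k _ => hG20 n hn1 k ω
    have hu0 : 0 ≤ ∑ k, U n k ω := Finset.sum_nonneg fun k _ => hU0 n k ω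
    have hηh : 0 ≤ 8 * R * η * h n := mul_nonneg (by positivity) (hh0 n)
    have hbig : 1 ≤ (if n ≤ K then (1 : ℝ) else 0) + (G1 n ω + ∑ k, G2 n k ω + ∑ k, U n k ω) →
        gap n (κ n ω) ≤ R * (if n ≤ K then 1 else 0) + 8 * R * η * h n +
          R * (G1 n ω + ∑ k, G2 n k ω + ∑ k, U n k ω) := fun hle => by
      have := hgapR n hn1 (κ n ω)
      nlinarith
    by_cases hnK : n ≤ K
    · exact hbig (by rw [if_pos hnK]; linarith)
    rw [if_neg hnK] at hbig ⊢
    rw [zero_add] at hbig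
    by_cases hopt : klIndex r c τ (fun t => κ t ω) (fun t => X t ω) n (j n) <
        r (j n) * (θ n (j n) - σ * τ)
    · exact hbig (by linarith [hG1 n hn1 ω hopt])
    by_cases hpulls : pulls τ (fun t => κ t ω) n (κ n ω) < N
    · refine hbig ?_
      have : U n (κ n ω) ω = 1 := by exact if_pos ⟨rfl, hpulls⟩
      have := Finset.single_le_sum (f := fun k => U n k ω) (fun k _ => hU0 n k ω)
        (Finset.mem_univ (κ n ω))
      linarith
    have hm : 4 * f / η ^ 2 ≤ pulls τ (fun t => κ t ω) n (κ n ω) :=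
      Nat.ceil_le.mp (not_lt.mp hpulls)
    by_cases hdev : (θ n (κ n ω) + σ * τ + η) * (pulls τ (fun t => κ t ω) n (κ n ω) : ℝ) ≤
          outcomeCount (window τ n) (fun t => κ t ω) (fun t => X t ω) (κ n ω) true
    · refine hbig ?_
      have h1 := hG2 n hn1 (κ n ω) ω hm hdev
      have := Finset.single_le_sum (f := fun k => G2 n k ω) (fun k _ => hG20 n hn1 k ω)
        (Finset.mem_univ (κ n ω))
      linarith
    have hfin : gap n (κ n ω) ≤ 8 * R * η := by
      simp only [hgap, ← hj n]
      exact gap_le_of_follows (κ := fun t => κ t ω) (x := fun t => X t ω) hr hR hη hστ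
        (by positivity) hf (h01 n hn1) (hω.2 n (by omega) (j n)) (not_lt.mp hopt) hm hdev
    have hrest : 0 ≤ R * (G1 n ω + ∑ k, G2 n k ω + ∑ k, U n k ω) := by positivity
    -- An optimal selection costs nothing; a strictly suboptimal one is charged to a close pair of
    -- neighbours.
    rcases (hgap0 n (κ n ω)).eq_or_lt with h0 | h0
    · linarith
    · have h1 : 1 ≤ h n := by
        simp only [hgap, ← hj n] at h0 hfin
        exact one_le_sum_close hr (hu n hn1) (hjmax n) (by linarith) hfin
      nlinarith [mul_le_mul_of_nonneg_left h1 (by positivity : 0 ≤ 8 * R * η)]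
  have hκm (n : ℕ) (hn : 1 ≤ n) : Measurable (κ n) := by
    obtain ⟨m, rfl⟩ : ∃ m, n = m + 1 := ⟨n - 1, by omega⟩
    exact (hA.predictable m).mono (ℱ.le _) le_rfl
  have hgapi (n : ℕ) (hn : n ∈ Finset.Icc 1 T) : Integrable (fun ω => gap n (κ n ω)) P := by
    have hn1 : 1 ≤ n := (Finset.mem_Icc.mp hn).1
    refine Integrable.of_bound ((measurable_of_finite (gap n)).comp
      (hκm n hn1)).aestronglyMeasurable R (Eventually.of_forall fun ω => ?_)
    rw [Real.norm_of_nonneg (hgap0 _ _)]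
    exact hgapR n hn1 _
  set D : ℝ := K * R + 8 * R * η * closeCount r θ (8 * R * η) T +
    R * (K * (N * (T / ⌊τ⌋₊ + 1 : ℕ))) with hD
  have hsum : ∀ᵐ ω ∂P, ∑ n ∈ Finset.Icc 1 T, gap n (κ n ω) ≤
      D + R * ∑ n ∈ Finset.Icc 1 T, (G1 n ω + ∑ k, G2 n k ω) := by
    filter_upwards [hpt] with ω hω
    have h1 : ∑ n ∈ Finset.Icc 1 T, (if n ≤ K then (1 : ℝ) else 0) ≤ K := by
      rw [Finset.sum_boole]
      have : (Finset.Icc 1 T).filter (fun n => n ≤ K) ⊆ Finset.Icc 1 K := fun n hn => by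
        simp only [Finset.mem_filter, Finset.mem_Icc] at hn ⊢
        exact ⟨hn.1.1, hn.2⟩
      have := Finset.card_le_card this
      rw [Nat.card_Icc, Nat.add_sub_cancel] at this
      exact_mod_cast this
    have h2 : ∑ n ∈ Finset.Icc 1 T, ∑ k, U n k ω ≤ K * (N * (T / ⌊τ⌋₊ + 1 : ℕ)) := by
      rw [Finset.sum_comm]
      calc _ ≤ ∑ _k : Fin K, ((N * (T / ⌊τ⌋₊ + 1) : ℕ) : ℝ) := by
            refine Finset.sum_le_sum fun k _ => ?_
            simp only [hU]
            rw [Finset.sum_boole]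
            exact_mod_cast card_underexplored_le hτ (fun t => κ t ω) k N T
        _ = _ := by simp
    calc _ ≤ ∑ n ∈ Finset.Icc 1 T, (R * (if n ≤ K then 1 else 0) + 8 * R * η * h n +
          R * (G1 n ω + ∑ k, G2 n k ω + ∑ k, U n k ω)) := Finset.sum_le_sum hω
      _ = R * ∑ n ∈ Finset.Icc 1 T, (if n ≤ K then 1 else 0) +
          8 * R * η * ∑ n ∈ Finset.Icc 1 T, h n +
          R * (∑ n ∈ Finset.Icc 1 T, (G1 n ω + ∑ k, G2 n k ω) +
            ∑ n ∈ Finset.Icc 1 T, ∑ k, U n k ω) := by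
        rw [Finset.sum_add_distrib, Finset.sum_add_distrib, ← Finset.mul_sum, ← Finset.mul_sum,
          ← Finset.mul_sum, Finset.sum_add_distrib]
      _ ≤ _ := by
        have h3 := mul_le_mul_of_nonneg_left h1 hR0.le
        have h4 := mul_le_mul_of_nonneg_left h2 hR0.le
        have h5 : closeCount r θ (8 * R * η) T = ∑ n ∈ Finset.Icc 1 T, h n := rfl
        rw [hD, h5]
        linarith
  have hGi (n : ℕ) (hn : n ∈ Finset.Icc 1 T) :
      Integrable (fun ω => G1 n ω + ∑ k, G2 n k ω) P := by
    have hn1 : 1 ≤ n := (Finset.mem_Icc.mp hn).1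
    exact (hG1i n hn1).add (integrable_finsetSum _ fun k _ => hG2i n hn1 k)
  have hGle : ∑ n ∈ Finset.Icc 1 T, ∫ ω, (G1 n ω + ∑ k, G2 n k ω) ∂P ≤
      T * (J * Real.exp (-(f / 2)) + K * Real.exp (-f)) := by
    calc _ ≤ ∑ _n ∈ Finset.Icc 1 T, (J * Real.exp (-(f / 2)) + K * Real.exp (-f)) := by
          refine Finset.sum_le_sum fun n hn => ?_
          have hn1 : 1 ≤ n := (Finset.mem_Icc.mp hn).1
          rw [integral_add (hG1i n hn1) (integrable_finsetSum _ fun k _ => hG2i n hn1 k),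
            integral_finsetSum _ fun k _ => hG2i n hn1 k]
          refine add_le_add (hG1le n hn1) ?_
          calc _ ≤ ∑ _k : Fin K, Real.exp (-f) := Finset.sum_le_sum fun k _ => hG2le n hn1 k
            _ = _ := by simp
      _ = _ := by rw [Finset.sum_const, Nat.card_Icc, Nat.add_sub_cancel, nsmul_eq_mul]
  calc regret P r θ κ T = ∫ ω, ∑ n ∈ Finset.Icc 1 T, gap n (κ n ω) ∂P :=
        (integral_finsetSum _ hgapi).symm
    _ ≤ ∫ ω, D + R * ∑ n ∈ Finset.Icc 1 T, (G1 n ω + ∑ k, G2 n k ω) ∂P :=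
        integral_mono_ae (integrable_finsetSum _ hgapi)
          ((integrable_const D).add ((integrable_finsetSum _ hGi).const_mul R)) hsum
    _ = D + R * ∑ n ∈ Finset.Icc 1 T, ∫ ω, (G1 n ω + ∑ k, G2 n k ω) ∂P := by
        rw [integral_add (integrable_const D) ((integrable_finsetSum _ hGi).const_mul R),
          integral_const_mul, integral_finsetSum _ hGi]
        simp
    _ ≤ D + R * (T * (J * Real.exp (-(f / 2)) + K * Real.exp (-f))) := by gcongr
    _ = _ := by rw [hD]; ring

/-! ### The long-run average regret -/

theorem closeCount_le {K : ℕ} (r : Fin K → ℝ) (θ : ℕ → Fin K → ℝ) (Δ : ℝ) (T : ℕ) :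
    closeCount r θ Δ T ≤ T * (K * K) := by
  calc closeCount r θ Δ T ≤ ∑ _n ∈ Finset.Icc 1 T, ∑ _k : Fin K, (K : ℝ) := by
        refine Finset.sum_le_sum fun n _ => Finset.sum_le_sum fun k _ => ?_
        calc _ ≤ ∑ _l ∈ neighbors r (θ n) k, (1 : ℝ) :=
              Finset.sum_le_sum fun l _ => by split_ifs <;> norm_num
          _ = ((neighbors r (θ n) k).card : ℝ) := by simp
          _ ≤ K := by
              have := Finset.card_le_univ (neighbors r (θ n) k)
              rw [Fintype.card_fin] at this
              exact_mod_cast this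
    _ = _ := by simp

theorem regret_nonneg {K : ℕ} {Ω : Type*} [MeasurableSpace Ω] (P : Measure Ω)
    (r : Fin K → ℝ) (θ : ℕ → Fin K → ℝ) (κ : ℕ → Ω → Fin K) (T : ℕ) :
    0 ≤ regret P r θ κ T :=
  Finset.sum_nonneg fun t _ => integral_nonneg fun ω => sub_nonneg.mpr <|
    le_ciSup (f := fun k => r k * θ t k) (Set.finite_range _).bddAbove (κ t ω)

theorem limsup_regret_le {K : ℕ} [NeZero K] {Ω : Type*} [mΩ : MeasurableSpace Ω] {P : Measure Ω}
    [IsProbabilityMeasure P] {θ : ℕ → Fin K → ℝ} {ℱ : Filtration ℕ mΩ}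
    {X : ℕ → Ω → Fin K → Bool} {κ : ℕ → Ω → Fin K} {r : Fin K → ℝ} {c τ σ η R φ Δ₀ : ℝ}
    (hr : ∀ k, 0 < r k) (hR : ∀ k, r k ≤ R) (hσ : 0 < σ) (hτ : 1 ≤ τ)
    (hθ : LipschitzDrift σ θ) (hu : ∀ t, 1 ≤ t → WeaklyUnimodal r (θ t))
    (hsep : Separated r θ φ Δ₀)
    (hE : IsEnvironment P θ ℱ X) (hA : IsSWKLRUCB P r c τ ℱ X κ)
    (hf : 0 < Real.log τ + c * Real.log (Real.log τ)) {J : ℕ} (hJ : ⌊τ⌋₊ < 2 ^ J)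
    (hη : 0 < η) (hη1 : η ≤ 1) (hΔ : 8 * R * η ≤ Δ₀) (hστ : σ * τ ≤ η) :
    limsup (fun T : ℕ => regret P r θ κ T / (T : ℝ)) atTop ≤
      8 * R * η * (φ * (8 * R * η) / r 0) +
      R * ((J * Real.exp (-((Real.log τ + c * Real.log (Real.log τ)) / 2)) +
          K * Real.exp (-(Real.log τ + c * Real.log (Real.log τ)))) +
        K * (⌈4 * (Real.log τ + c * Real.log (Real.log τ)) / η ^ 2⌉₊ / (⌊τ⌋₊ : ℝ))) := by
  have hR0 : 0 < R := (hr 0).trans_le (hR 0)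
  set f := Real.log τ + c * Real.log (Real.log τ) with hfdef
  set N := ⌈4 * f / η ^ 2⌉₊
  have hL : (0 : ℝ) < ⌊τ⌋₊ := by exact_mod_cast Nat.floor_pos.mpr hτ
  set Q : ℝ := J * Real.exp (-(f / 2)) + K * Real.exp (-f) with hQ
  refine le_of_forall_pos_le_add fun ε hε => ?_
  -- A real `limsup` is meaningful only with boundedness: `regret_nonneg` supplies it here, and
  -- `closeCount_le` for the close counts.
  have hcob : IsCoboundedUnder (· ≤ ·) atTop fun T : ℕ => regret P r θ κ T / (T : ℝ) := by
    refine IsBoundedUnder.isCoboundedUnder_le (isBoundedUnder_of ⟨0, fun T => ?_⟩)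
    exact div_nonneg (regret_nonneg P r θ κ T) (Nat.cast_nonneg T)
  refine limsup_le_of_le hcob ?_
  have hbdd : IsBoundedUnder (· ≤ ·) atTop
      fun T : ℕ => closeCount r θ (8 * R * η) T / (T : ℝ) := by
    refine isBoundedUnder_of ⟨K * K, fun T => ?_⟩
    exact div_le_of_le_mul₀ (Nat.cast_nonneg T) (by positivity)
      (by linarith [closeCount_le r θ (8 * R * η) T])
  have hclose : ∀ᶠ T : ℕ in atTop, closeCount r θ (8 * R * η) T / (T : ℝ) <
      φ * (8 * R * η) / r 0 + ε / 2 / (8 * R * η) := by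
    refine eventually_lt_of_limsup_lt ?_ hbdd
    have := hsep (8 * R * η) (by positivity) hΔ
    have : 0 < ε / 2 / (8 * R * η) := by positivity
    linarith
  have hvanish : ∀ᶠ T : ℕ in atTop, (K * R + R * (K * N)) / (T : ℝ) < ε / 2 :=
    (tendsto_const_div_atTop_nhds_zero_nat _).eventually (gt_mem_nhds (by positivity))
  filter_upwards [hclose, hvanish, eventually_gt_atTop 0] with T h1 h2 hT
  have hT' : (0 : ℝ) < T := by exact_mod_cast hT
  have h3 := regret_le hr hR hσ hτ hθ hu hE hA hf hJ hη hη1 hστ T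
  have h4 : ((T / ⌊τ⌋₊ + 1 : ℕ) : ℝ) ≤ T / (⌊τ⌋₊ : ℝ) + 1 := by
    push_cast
    have := Nat.cast_div_le (α := ℝ) (m := T) (n := ⌊τ⌋₊)
    linarith
  have h5 : 8 * R * η * (closeCount r θ (8 * R * η) T / (T : ℝ)) ≤
      8 * R * η * (φ * (8 * R * η) / r 0) + ε / 2 := by
    have := mul_le_mul_of_nonneg_left h1.le (by positivity : 0 ≤ 8 * R * η)
    rwa [mul_add, mul_div_cancel₀ _ (by positivity : 8 * R * η ≠ 0)] at this
  calc regret P r θ κ T / (T : ℝ)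
      ≤ (K * R + 8 * R * η * closeCount r θ (8 * R * η) T +
          R * (T * Q + K * (N * (T / (⌊τ⌋₊ : ℝ) + 1)))) / T := by
        refine div_le_div_of_nonneg_right (h3.trans ?_) hT'.le
        gcongr
    _ = 8 * R * η * (closeCount r θ (8 * R * η) T / (T : ℝ)) +
          R * (Q + K * (N / (⌊τ⌋₊ : ℝ))) + (K * R + R * (K * N)) / (T : ℝ) := by
        field_simp
        ring
    _ ≤ _ := by linarith

/-! ### The window size -/

/-- Used with L = log τ. The middle term is the peeling cost, and it is o(L) only because c > 0. -/
theorem eventually_sqrt_add_rpow_le {c ε : ℝ} (hc : 0 < c) (hε : 0 < ε) (a b d : ℝ) :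
    ∀ᶠ L : ℝ in atTop, a * √L + b * (L * L ^ (-(c / 2))) + d ≤ ε * L := by
  have h1 : Tendsto (fun L : ℝ => a * (√L)⁻¹ + b * L ^ (-(c / 2)) + d * L⁻¹) atTop
      (𝓝 (a * 0 + b * 0 + d * 0)) :=
    (((tendsto_inv_atTop_zero.comp Real.tendsto_sqrt_atTop).const_mul a).add
      ((tendsto_rpow_neg_atTop (by positivity)).const_mul b)).add
      (tendsto_inv_atTop_zero.const_mul d)
  simp only [mul_zero, add_zero] at h1
  filter_upwards [h1.eventually (gt_mem_nhds hε), eventually_gt_atTop 0] with L h2 hL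
  have h3 := mul_le_mul_of_nonneg_right h2.le hL.le
  have h4 : (√L)⁻¹ * L = √L := by
    rw [inv_mul_eq_div, Real.div_sqrt]
  have h5 : L⁻¹ * L = 1 := inv_mul_cancel₀ hL.ne'
  calc _ = (a * (√L)⁻¹ + b * L ^ (-(c / 2)) + d * L⁻¹) * L := by
        rw [add_mul, add_mul, mul_assoc a, h4, mul_assoc d, h5]; ring
    _ ≤ _ := h3

theorem eventually_window_large {c R φ Δ₀ ρ : ℝ} (hc : 0 < c) (hφ : 0 < φ)
    (hΔ₀ : 0 < Δ₀) (K : ℕ) :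
    ∀ᶠ τ : ℝ in atTop, 1 ≤ Real.log τ ∧ √√(Real.log τ / τ) ≤ 1 ∧
      8 * R * √√(Real.log τ / τ) ≤ Δ₀ ∧
      (64 * R ^ 2 * φ / ρ + R * K * (8 * (1 + c))) * √(Real.log τ) +
        3 * R * (Real.log τ * Real.log τ ^ (-(c / 2))) + 3 * R * K ≤ φ / 2 * Real.log τ := by
  have h0 : Tendsto (fun τ : ℝ => √√(Real.log τ / τ)) atTop (𝓝 0) := by
    have h := (Real.isLittleO_log_id_atTop.tendsto_div_nhds_zero).sqrt.sqrt
    simpa using h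
  have h1 : Tendsto (fun τ : ℝ => 8 * R * √√(Real.log τ / τ)) atTop (𝓝 0) := by
    simpa using h0.const_mul (8 * R)
  filter_upwards [Real.tendsto_log_atTop.eventually_ge_atTop 1,
    h0.eventually (gt_mem_nhds one_pos), h1.eventually (gt_mem_nhds hΔ₀),
    Real.tendsto_log_atTop.eventually (eventually_sqrt_add_rpow_le hc (half_pos hφ)
      (64 * R ^ 2 * φ / ρ + R * K * (8 * (1 + c))) (3 * R) (3 * R * K))] with τ a1 a2 a3 a4
  exact ⟨a1, a2.le, a3.le, a4⟩

/-- The bound of `limsup_regret_le` for a large window. -/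
theorem regret_rate_le {c R φ ρ τ η : ℝ} {K : ℕ} (hc : 0 < c) (hR : 0 < R)
    (hτ : 1 ≤ τ) (hL : 1 ≤ Real.log τ) (hη : η = √√(Real.log τ / τ))
    (hlarge : (64 * R ^ 2 * φ / ρ + R * K * (8 * (1 + c))) * √(Real.log τ) +
      3 * R * (Real.log τ * Real.log τ ^ (-(c / 2))) + 3 * R * K ≤ φ / 2 * Real.log τ) :
    8 * R * η * (φ * (8 * R * η) / ρ) +
      R * ((((Nat.log 2 ⌊τ⌋₊ + 1 : ℕ) : ℝ) *
            Real.exp (-((Real.log τ + c * Real.log (Real.log τ)) / 2)) +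
          K * Real.exp (-(Real.log τ + c * Real.log (Real.log τ)))) +
        K * (⌈4 * (Real.log τ + c * Real.log (Real.log τ)) / η ^ 2⌉₊ / (⌊τ⌋₊ : ℝ))) ≤
      (√τ)⁻¹ * (φ / 2 * Real.log τ) := by
  have hτ0 : 0 < τ := by linarith
  set L := Real.log τ with hLdef
  have hL0 : 0 < L := by linarith
  have hs : 0 < √τ := Real.sqrt_pos.mpr hτ0
  have hss : √τ * √τ = τ := Real.mul_self_sqrt hτ0.le
  have hs1 : 1 ≤ √τ := Real.one_le_sqrt.mpr hτ
  have hsL1 : 1 ≤ √L := Real.one_le_sqrt.mpr hL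
  have hη2 : η ^ 2 = √L * (√τ)⁻¹ := by
    rw [hη, Real.sq_sqrt (Real.sqrt_nonneg _), Real.sqrt_div hL0.le, div_eq_mul_inv]
  have hlog0 : 0 ≤ Real.log L := Real.log_nonneg hL
  have hlogL : Real.log L ≤ L := (Real.log_le_sub_one_of_pos hL0).trans (by linarith)
  set f := L + c * Real.log L with hf
  have hf1 : L ≤ f := by
    have : 0 ≤ c * Real.log L := by positivity
    linarith
  have hf2 : f ≤ (1 + c) * L := by nlinarith
  have e1 : 8 * R * η * (φ * (8 * R * η) / ρ) = (√τ)⁻¹ * (64 * R ^ 2 * φ / ρ * √L) := by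
    calc _ = 64 * R ^ 2 * φ / ρ * η ^ 2 := by ring
      _ = _ := by rw [hη2]; ring
  -- The number of dyadic ranges is at most L / log 2 + 1, with 1 / log 2 < 2 and 1 ≤ L.
  have e2 : ((Nat.log 2 ⌊τ⌋₊ + 1 : ℕ) : ℝ) ≤ 3 * L := by
    have h1 : (Nat.log 2 ⌊τ⌋₊ : ℝ) * Real.log 2 ≤ L := by
      have h2 : (2 : ℝ) ^ Nat.log 2 ⌊τ⌋₊ ≤ τ := by
        have h3 := Nat.pow_log_le_self 2 (Nat.floor_pos.mpr hτ).ne'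
        have h4 : ((2 ^ Nat.log 2 ⌊τ⌋₊ : ℕ) : ℝ) ≤ (⌊τ⌋₊ : ℝ) := by exact_mod_cast h3
        push_cast at h4
        exact h4.trans (Nat.floor_le hτ0.le)
      have := Real.log_le_log (by positivity) h2
      rwa [Real.log_pow] at this
    have h2 := Real.log_two_gt_d9
    have h3 : (0 : ℝ) ≤ Nat.log 2 ⌊τ⌋₊ := Nat.cast_nonneg _
    push_cast
    nlinarith
  have e3 : Real.exp (-(f / 2)) = (√τ)⁻¹ * L ^ (-(c / 2)) := by
    rw [Real.rpow_def_of_pos hL0, ← Real.exp_log hs, ← Real.exp_neg, ← Real.exp_add,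
      Real.log_sqrt hτ0.le]
    congr 1
    rw [hf]; ring
  have e4 : Real.exp (-f) ≤ (√τ)⁻¹ := by
    calc Real.exp (-f) ≤ Real.exp (-L) := Real.exp_le_exp.mpr (by linarith)
      _ = τ⁻¹ := by rw [Real.exp_neg, hLdef, Real.exp_log hτ0]
      _ ≤ (√τ)⁻¹ := inv_anti₀ hs (by nlinarith)
  have e5 : (⌈4 * f / η ^ 2⌉₊ : ℝ) / (⌊τ⌋₊ : ℝ) ≤ (√τ)⁻¹ * (8 * (1 + c) * √L + 2) := by
    have h1 : (τ / 2 : ℝ) ≤ ⌊τ⌋₊ := by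
      have h2 := Nat.lt_floor_add_one τ
      have h3 : (1 : ℝ) ≤ ⌊τ⌋₊ := by exact_mod_cast Nat.floor_pos.mpr hτ
      linarith
    have hη2' : 0 < η ^ 2 := by rw [hη2]; positivity
    have h2 : 4 * f / η ^ 2 ≤ 4 * (1 + c) * √L * √τ := by
      rw [div_le_iff₀ hη2', hη2]
      have h3 : 4 * (1 + c) * √L * √τ * (√L * (√τ)⁻¹) = 4 * ((1 + c) * (√L * √L)) := by
        field_simp
      rw [h3, Real.mul_self_sqrt hL0.le]
      linarith
    have h4 := (Nat.ceil_lt_add_one (by positivity : 0 ≤ 4 * f / η ^ 2)).le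
    rw [div_le_iff₀ (by linarith)]
    calc (⌈4 * f / η ^ 2⌉₊ : ℝ) ≤ 4 * (1 + c) * √L * √τ + 1 := by linarith
      _ ≤ 4 * (1 + c) * √L * √τ + √τ := by linarith
      _ = (√τ)⁻¹ * (8 * (1 + c) * √L + 2) * (τ / 2) := by
        have h5 : (√τ)⁻¹ * τ = √τ := by rw [inv_mul_eq_div, Real.div_sqrt]
        linear_combination (-(4 * (1 + c) * √L + 1)) * h5
      _ ≤ _ := mul_le_mul_of_nonneg_left h1 (by positivity)
  have e6 : ((Nat.log 2 ⌊τ⌋₊ + 1 : ℕ) : ℝ) * Real.exp (-(f / 2)) ≤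
      (√τ)⁻¹ * (3 * (L * L ^ (-(c / 2)))) := by
    rw [e3]
    calc _ ≤ 3 * L * ((√τ)⁻¹ * L ^ (-(c / 2))) :=
          mul_le_mul_of_nonneg_right e2 (by positivity)
      _ = _ := by ring
  calc _ ≤ (√τ)⁻¹ * (64 * R ^ 2 * φ / ρ * √L) + R * (((√τ)⁻¹ * (3 * (L * L ^ (-(c / 2)))) +
        K * (√τ)⁻¹) + K * ((√τ)⁻¹ * (8 * (1 + c) * √L + 2))) := by
        rw [e1]; gcongr
    _ = (√τ)⁻¹ * ((64 * R ^ 2 * φ / ρ + R * K * (8 * (1 + c))) * √L +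
        3 * R * (L * L ^ (-(c / 2))) + 3 * R * K) := by ring
    _ ≤ _ := mul_le_mul_of_nonneg_left hlarge (by positivity)

/-- The exponent -4/5 is the one that makes the drift y τ of order τ^(-1/4), which is `η` up to the
logarithm. -/
theorem window_pow_five {y τ : ℝ} (hy : 0 < y) (hτ : τ = y ^ (-(4 / 5) : ℝ) / 4) :
    (y * τ) ^ 4 * τ = 1 / 1024 := by
  have h : (y ^ (-(4 / 5) : ℝ)) ^ 5 * y ^ 4 = 1 := by
    rw [← Real.rpow_natCast, ← Real.rpow_mul hy.le, ← Real.rpow_natCast, ← Real.rpow_add hy]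
    norm_num
  rw [hτ]
  linear_combination h / 1024

theorem rpow_two_fifths_eq {y τ : ℝ} (hy : 0 < y) (hτ : τ = y ^ (-(4 / 5) : ℝ) / 4) :
    y ^ (2 / 5 : ℝ) = (√τ)⁻¹ / 2 := by
  have h1 : √τ = y ^ (-(2 / 5) : ℝ) / 2 := by
    rw [Real.sqrt_eq_iff_mul_self_eq (by rw [hτ]; positivity) (by positivity), hτ]
    have : y ^ (-(2 / 5) : ℝ) * y ^ (-(2 / 5) : ℝ) = y ^ (-(4 / 5) : ℝ) := by
      rw [← Real.rpow_add hy]; norm_num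
    linear_combination -this / 4
  rw [h1, Real.rpow_neg hy.le]
  field_simp

end RateBandit

end

/-! ### The choice of the constants -/

theorem mainTheorem11 :
    ∃ C : ℝ, 0 < C ∧
      ∀ (K : ℕ) [NeZero K] (r : Fin K → ℝ), StrictMono r → 0 < r 0 →
      ∀ (c : ℝ), 0 < c →
      ∀ (Φ : ℕ → ℝ), 0 < Φ K → Φ K ≤ (K : ℝ) →
      ∀ (Δ₀ : ℝ), 0 < Δ₀ →
      ∃ σ₀ : ℝ, 0 < σ₀ ∧
        ∀ (σ : ℝ), 0 < σ → σ < σ₀ →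
        ∀ (θ : ℕ → Fin K → ℝ),
          RateBandit.LipschitzDrift σ θ →
          (∀ t : ℕ, 1 ≤ t → RateBandit.WeaklyUnimodal r (θ t)) →
          RateBandit.Separated r θ (Φ K) Δ₀ →
        ∀ (τ : ℝ), τ = ((K : ℝ) * σ / Φ K) ^ (-(4 / 5) : ℝ) / 4 →
        ∀ (Ω : Type*) [MeasurableSpace Ω] (P : Measure Ω) [IsProbabilityMeasure P]
          (ℱ : Filtration ℕ ‹MeasurableSpace Ω›)
          (X : ℕ → Ω → Fin K → Bool) (κ : ℕ → Ω → Fin K),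
          RateBandit.IsEnvironment P θ ℱ X →
          RateBandit.IsSWKLRUCB P r c τ ℱ X κ →
          limsup (fun T : ℕ => RateBandit.regret P r θ κ T / (T : ℝ)) atTop ≤
            C * Φ K * ((K : ℝ) * σ / Φ K) ^ (2 / 5 : ℝ) * Real.log (1 / σ) := by
  refine ⟨1, one_pos, fun K _ r hmono hr0 c hc Φ hΦ hΦK Δ₀ hΔ₀ => ?_⟩
  have hr : ∀ k, 0 < r k := fun k => hr0.trans_le (hmono.monotone (Fin.zero_le k))
  obtain ⟨R, hR⟩ : ∃ R, ∀ k, r k ≤ R := by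
    obtain ⟨R, hR⟩ := (Set.finite_range r).bddAbove
    exact ⟨R, fun k => hR (Set.mem_range_self k)⟩
  have hR0 : 0 < R := hr0.trans_le (hR 0)
  have hK : (0 : ℝ) < K := hΦ.trans_le hΦK
  -- The window length tends to infinity as σ → 0⁺, so the largeness conditions on τ define σ₀
  -- independently of θ.
  have hlim : Tendsto (fun σ : ℝ => ((K : ℝ) * σ / Φ K) ^ (-(4 / 5) : ℝ) / 4) (𝓝[>] 0) atTop := by
    have h1 : Tendsto (fun σ : ℝ => (K : ℝ) * σ / Φ K) (𝓝[>] 0) (𝓝[>] 0) := by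
      refine tendsto_nhdsWithin_iff.mpr ⟨?_, ?_⟩
      · have : Tendsto (fun σ : ℝ => (K : ℝ) * σ / Φ K) (𝓝 0) (𝓝 ((K : ℝ) * 0 / Φ K)) :=
          (tendsto_id.const_mul (K : ℝ)).div_const _
        rw [mul_zero, zero_div] at this
        exact this.mono_left nhdsWithin_le_nhds
      · filter_upwards [self_mem_nhdsWithin] with σ hσ
        exact div_pos (mul_pos hK hσ) hΦ
    exact ((tendsto_rpow_neg_nhdsGT_zero (by norm_num)).comp h1).atTop_div_const (by norm_num)
  obtain ⟨σ₀, hσ₀, hsub⟩ := mem_nhdsGT_iff_exists_Ioo_subset.mp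
    (hlim.eventually ((eventually_ge_atTop 1).and (RateBandit.eventually_window_large (R := R)
      (ρ := r 0) hc hΦ hΔ₀ K)))
  refine ⟨σ₀, hσ₀, fun σ hσ hσlt θ hθ hu hsep τ hτ Ω _ P _ ℱ X κ hE hA => ?_⟩
  have hlarge := hsub ⟨hσ, hσlt⟩
  simp only [Set.mem_ofPred_eq, ← hτ] at hlarge
  obtain ⟨hτ1, hL, hη1, hηΔ, hlarge⟩ := hlarge
  set y := (K : ℝ) * σ / Φ K with hy
  have hy0 : 0 < y := div_pos (mul_pos hK hσ) hΦ
  have hσy : σ ≤ y := by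
    rw [hy, le_div_iff₀ hΦ, mul_comm]
    exact mul_le_mul_of_nonneg_right hΦK hσ.le
  have hτ0 : 0 < τ := by linarith
  have h5 := RateBandit.window_pow_five hy0 hτ
  have hyτ : (y * τ) ^ 4 ≤ 1 / τ := by
    rw [le_div_iff₀ hτ0, h5]; norm_num
  have hστ : σ * τ ≤ √√(Real.log τ / τ) := by
    apply Real.le_sqrt_of_sq_le
    apply Real.le_sqrt_of_sq_le
    calc ((σ * τ) ^ 2) ^ 2 = (σ * τ) ^ 4 := by ring
      _ ≤ (y * τ) ^ 4 := by gcongr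
      _ ≤ 1 / τ := hyτ
      _ ≤ Real.log τ / τ := by gcongr
  -- Since Φ(K) ≤ K gives σ ≤ y, it follows that σ τ ≤ y τ ≤ 1.
  have hlog : Real.log τ ≤ Real.log (1 / σ) := by
    refine Real.log_le_log hτ0 ?_
    rw [le_div_iff₀ hσ]
    have h6 : (y * τ) ^ 4 ≤ 1 := hyτ.trans (by rw [div_le_one hτ0]; exact hτ1)
    have h7 : y * τ ≤ 1 := (pow_le_one_iff_of_nonneg (by positivity) (by norm_num)).mp h6
    nlinarith
  have hlog0 : 0 < Real.log τ := by linarith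
  have hη0 : 0 < √√(Real.log τ / τ) := by positivity
  have hf : 0 < Real.log τ + c * Real.log (Real.log τ) := by
    have := mul_nonneg hc.le (Real.log_nonneg hL)
    linarith
  refine (RateBandit.limsup_regret_le hr hR hσ hτ1 hθ hu hsep hE hA hf
    (Nat.lt_pow_succ_log_self (by norm_num) _) hη0 hη1 hηΔ hστ).trans
    ((RateBandit.regret_rate_le hc hR0 hτ1 hL rfl hlarge).trans ?_)
  -- The factor 1/2 in y^(2/5) = (√τ)⁻¹ / 2 matches the one in Φ(K) / 2, leaving C = 1.
  rw [RateBandit.rpow_two_fifths_eq hy0 hτ]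
  calc (√τ)⁻¹ * (Φ K / 2 * Real.log τ) ≤ (√τ)⁻¹ * (Φ K / 2 * Real.log (1 / σ)) := by gcongr
    _ = _ := by ring
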